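/- Conventions. "Increasing" means nondecreasing. $\mathbb R^{\mathbb R}$ carries its cylindrical $\sigma$-algebra; for a probability measure $P$ on $\mathbb R^{\mathbb R}$ and $X=(X_t)_{t\in\mathbb R}$ a process of law $P$, $P^{s,t}=\mathrm{Law}(X_s,X_t)$. For a family $\mu=(\mu_t)_{t\in\mathbb R}$ of probability measures on $\mathbb R$, $\mathrm{Marg}(\mu)$ is the set of probability measures on $\mathbb R^{\mathbb R}$ with $\mathrm{Law}(X_t)=\mu_t$ for all $t$. The stochastic order is: $\nu\preceq_{\rm sto}\nu'$ iff $\nu(]-\infty,x])\ge\nu'(]-\infty,x])$ for all $x\in\mathbb R$. $P$ is Markov if $\mathrm{Law}(X_t\mid (X_u)_{u\le s})=\mathrm{Law}(X_t\mid X_s)$ for all $s<t$. $P$ has increasing kernels if, for all $s<t$, the kernel $x\mapsto \mathrm{Law}(X_t\mid X_s=x)$ is increasing for $\preceq_{\rm sto}$ on a set of full measure for $\mathrm{Law}(X_s)$. With $G_\nu(q)=\inf\{x: \nu(]-\infty,x])\ge q\}$, the quantile coupling $\mathfrak Q(\nu,\nu')$ is the law of $(G_\nu,G_{\nu'})$ under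 Lebesgue measure on $]0,1[$, and $\mathfrak Q^{s,t}=\mathfrak Q(\mu_s,\mu_t)$. The product $\pi\cdot\rho$ of two transport plans $\pi$, $\rho$ (the second marginal of $\pi$ being the first one of $\rho$), with disintegration kernels $k_\pi$, $k_\rho$, is the measure with the first marginal of $\pi$ and kernel $k_\pi k_\rho$. For $s<t$ and a finite set $R=\{r_1<\dots<r_m\}\subset[s,t]$, $\mathfrak Q_{[R]}^{s,t}=\mathfrak Q^{s,r_1}\cdot\mathfrak Q^{r_1,r_2}\cdots\mathfrak Q^{r_m,t}$ (which is $\mathfrak Q^{s,t}$ if $R=\emptyset$). Theorem A. Let $\mu=(\mu_t)_{t\in\mathbb R}$ be any family of probability measures on $\mathbb R$. (a) There exists a unique measure $\mathfrak{MQ}\in\mathrm{Marg}(\mu)$ such that (i) $\mathfrak{MQ}$ is Markov, (ii) $\mathfrak{MQ}$ has increasing kernels, (iii) $\mathfrak{MQ}$ has minimal couplings among the measures of $\mathrm{Marg}(\mu)$ satisfying (i) and (ii): if $X$ has law $\mathfrak{MQ}$, then for all $s<t$ and all $x$ with $\mu_s(]-\infty,x])>0$, $$\mathrm{Law}(X_t\mid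 X_s\le x)=\min\{\mathrm{Law}(Y_t\mid Y_s\le x):\ \mathrm{Law}(Y)\in\mathrm{Marg}(\mu)\text{ satisfies (i) and (ii)}\},$$ the minimum being for $\preceq_{\rm sto}$. The measure $\mathfrak{MQ}$ is also the unique probability measure on $\mathbb R^{\mathbb R}$ that is Markov and such that (iv) for all $s<t$, $\mathfrak{MQ}^{s,t}$ is the weak limit of a sequence $(\mathfrak Q_{[R_n]}^{s,t})_{n\in\mathbb N}$, for some finite sets $R_n\subset[s,t]$ (depending on $s,t$). (b) If moreover $\mu_s\preceq_{\rm sto}\mu_t$ for all $s\le t$, then there is a process $X=(X_t)_{t\in\mathbb R}$ of law $\mathfrak{MQ}$, on some probability space $\Omega$, such that $t\mapsto X_t(\omega)$ is increasing for every $\omega\in\Omega$. -/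

import Mathlib

open MeasureTheory ProbabilityTheory Set Filter
open scoped Topology ENNReal ProbabilityTheory

noncomputable section

namespace MarkovQuantile

/-- The stochastic order on measures on the line: `ν ≼ ν'` iff the distribution function of `ν`
dominates the one of `ν'`. -/
def StoLE (ν ν' : Measure ℝ) : Prop :=
  ∀ x : ℝ, ν' (Iic x) ≤ ν (Iic x)

/-- The one-time marginal `P^t` of a probability measure on the path space `ℝ → ℝ`, which carries
its cylindrical (product) σ-algebra. -/
def marginal (P : ProbabilityMeasure (ℝ → ℝ)) (t : ℝ) : ProbabilityMeasure ℝ :=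
  P.map (f := fun w : ℝ → ℝ => w t) (measurable_pi_apply t).aemeasurable

/-- The two-time marginal `P^{s,t}`. -/
def coupling (P : ProbabilityMeasure (ℝ → ℝ)) (s t : ℝ) : ProbabilityMeasure (ℝ × ℝ) :=
  P.map (f := fun w : ℝ → ℝ => (w s, w t))
    ((measurable_pi_apply s).prodMk (measurable_pi_apply t)).aemeasurable

/-- `Marg μ`: the probability measures on `ℝ → ℝ` with one-time marginals `μ t`. -/
def Marg (μ : ℝ → ProbabilityMeasure ℝ) : Set (ProbabilityMeasure (ℝ → ℝ)) :=
  {P | ∀ t, marginal P t = μ t}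

/-- The σ-algebra on the path space generated by the coordinate at time `s`. -/
abbrev present (s : ℝ) : MeasurableSpace (ℝ → ℝ) :=
  MeasurableSpace.comap (fun w : ℝ → ℝ => w s) inferInstance

/-- The σ-algebra on the path space generated by the coordinates at all times `u ≤ s`. -/
abbrev past (s : ℝ) : MeasurableSpace (ℝ → ℝ) :=
  ⨆ u ∈ Iic s, present u

/-- Markov property: for `s < t`, the law of the coordinate `X_t` given `(X_u)_{u ≤ s}` is its law
given `X_s`. -/
def IsMarkov (P : ProbabilityMeasure (ℝ → ℝ)) : Prop :=
  ∀ s t : ℝ, s < t → ∀ B : Set ℝ, MeasurableSet B →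
    (P : Measure (ℝ → ℝ))⟦(fun w : ℝ → ℝ => w t) ⁻¹' B | past s⟧
      =ᵐ[(P : Measure (ℝ → ℝ))]
    (P : Measure (ℝ → ℝ))⟦(fun w : ℝ → ℝ => w t) ⁻¹' B | present s⟧

/-- A transport plan has increasing kernel if its disintegration `k` with respect to the first
marginal is increasing, for the stochastic order, on a set of full measure. The kernel is only
defined almost everywhere, and an increasing version on the whole line need not exist. -/
def HasIncreasingKernel (π : ProbabilityMeasure (ℝ × ℝ)) : Prop :=
  ∃ k : Kernel ℝ ℝ, IsMarkovKernel k ∧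
    (π : Measure (ℝ × ℝ)).fst ⊗ₘ k = (π : Measure (ℝ × ℝ)) ∧
    ∃ E : Set ℝ, (π : Measure (ℝ × ℝ)).fst Eᶜ = 0 ∧
      ∀ x ∈ E, ∀ y ∈ E, x ≤ y → StoLE (k x) (k y)

/-- A process has increasing kernels if all its couplings `P^{s,t}`, `s < t`, do. -/
def HasIncreasingKernels (P : ProbabilityMeasure (ℝ → ℝ)) : Prop :=
  ∀ s t : ℝ, s < t → HasIncreasingKernel (coupling P s t)

/-- `Law(X_t | X_s ≤ x)` where `X` has law `P`. -/
def condLaw (P : ProbabilityMeasure (ℝ → ℝ)) (s t x : ℝ) : Measure ℝ :=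
  ((P : Measure (ℝ → ℝ))[|{w : ℝ → ℝ | w s ≤ x}]).map (fun w : ℝ → ℝ => w t)

/-- For all `s < t` and all `x` with `μ_s(]-∞, x]) > 0`, `Law(X_t | X_s ≤ x)` is a lower bound, for
the stochastic order, of the laws `Law(Y_t | Y_s ≤ x)`, where `Y` ranges over the Markov processes
with marginals `μ` and increasing kernels. If `X` is itself such a process, this says that
`Law(X_t | X_s ≤ x)` is the minimum of these laws. -/
def HasMinimalCouplings (μ : ℝ → ProbabilityMeasure ℝ) (P : ProbabilityMeasure (ℝ → ℝ)) : Prop :=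
  ∀ s t : ℝ, s < t → ∀ x : ℝ, (μ s : Measure ℝ) (Iic x) ≠ 0 →
    ∀ Q ∈ Marg μ, IsMarkov Q → HasIncreasingKernels Q →
      StoLE (condLaw P s t x) (condLaw Q s t x)

/-- The quantile function `G_ν(q) = inf {x | q ≤ F_ν(x)}`; it is used for `q ∈ ]0,1[` only. -/
def quantileFun (ν : ProbabilityMeasure ℝ) (q : ℝ) : ℝ :=
  sInf {x : ℝ | q ≤ cdf (ν : Measure ℝ) x}

theorem monotoneOn_quantileFun (ν : ProbabilityMeasure ℝ) :
    MonotoneOn (quantileFun ν) (Ioo 0 1) := by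
  intro a ha b hb hab
  refine csInf_le_csInf ?_ ?_ (fun x hx => le_trans hab hx)
  · obtain ⟨m, hm⟩ := ((tendsto_cdf_atBot (ν : Measure ℝ)).eventually
      (gt_mem_nhds ha.1)).exists
    refine ⟨m, fun x hx => ?_⟩
    by_contra h
    have h1 := monotone_cdf (ν : Measure ℝ) (not_le.mp h).le
    have h2 : a ≤ cdf (ν : Measure ℝ) x := hx
    linarith
  · obtain ⟨m, hm⟩ := ((tendsto_cdf_atTop (ν : Measure ℝ)).eventually
      (lt_mem_nhds hb.2)).exists
    exact ⟨m, le_of_lt hm⟩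

theorem aemeasurable_quantileFun (ν : ProbabilityMeasure ℝ) :
    AEMeasurable (quantileFun ν) (volume.restrict (Ioo (0 : ℝ) 1)) :=
  aemeasurable_restrict_of_monotoneOn measurableSet_Ioo (monotoneOn_quantileFun ν)

/-- The quantile coupling: the law of `(G_ν, G_ν')` under the Lebesgue measure on `]0,1[`. -/
def quantileCoupling (ν ν' : ProbabilityMeasure ℝ) : ProbabilityMeasure (ℝ × ℝ) :=
  ⟨(volume.restrict (Ioo (0 : ℝ) 1)).map (fun q => (quantileFun ν q, quantileFun ν' q)), by
    have : IsProbabilityMeasure (volume.restrict (Ioo (0 : ℝ) 1)) := ⟨by simp⟩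
    exact Measure.isProbabilityMeasure_map
      ((aemeasurable_quantileFun ν).prodMk (aemeasurable_quantileFun ν'))⟩

/-- The product `π.ρ` of two transport plans: the law with the first marginal of `π` and kernel
`k_π.k_ρ` (first move according to the kernel of `π`, then according to the one of `ρ`). -/
def planMul (π ρ : ProbabilityMeasure (ℝ × ℝ)) : ProbabilityMeasure (ℝ × ℝ) :=
  ⟨(π : Measure (ℝ × ℝ)).fst ⊗ₘ
    ((ρ : Measure (ℝ × ℝ)).condKernel ∘ₖ (π : Measure (ℝ × ℝ)).condKernel), inferInstance⟩

/-- The product of the quantile couplings along the successive times `s, r₁, …, r_m, t`. -/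
def quantileChain (μ : ℝ → ProbabilityMeasure ℝ) (t : ℝ) :
    ℝ → List ℝ → ProbabilityMeasure (ℝ × ℝ)
  | s, [] => quantileCoupling (μ s) (μ t)
  | s, r :: l => planMul (quantileCoupling (μ s) (μ r)) (quantileChain μ t r l)

/-- `𝔔_{[R]}^{s,t}`: the product of the quantile couplings along `s, r₁, …, r_m, t`, where
`r₁ < … < r_m` are the elements of `R`. -/
def quantileProduct (μ : ℝ → ProbabilityMeasure ℝ) (s t : ℝ) (R : Finset ℝ) :
    ProbabilityMeasure (ℝ × ℝ) :=
  quantileChain μ t s (R.sort (· ≤ ·))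

/-- Every coupling `P^{s,t}`, `s < t`, is a weak limit of a sequence of products of quantile
couplings along finite subsets of `[s,t]`. -/
def IsLimitOfQuantileProducts (μ : ℝ → ProbabilityMeasure ℝ)
    (P : ProbabilityMeasure (ℝ → ℝ)) : Prop :=
  ∀ s t : ℝ, s < t → ∃ R : ℕ → Finset ℝ, (∀ n, (R n : Set ℝ) ⊆ Icc s t) ∧
    Tendsto (fun n => quantileProduct μ s t (R n)) atTop (𝓝 (coupling P s t))

end MarkovQuantile

end

/-! Plans with fixed marginals are compared by the lower orthant order `OrthLE`, that is, by the
mass of the quadrants `Iic x ×ˢ Iic y`. A larger plan has smaller conditional laws given `X_s ≤ x`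
for the stochastic order, so minimal couplings mean greatest two-time marginals. The quantile
coupling is the greatest plan of all (`orthLE_quantileCoupling`), but products of quantile couplings
depend on the intermediate times, so that they do not form a Markov family.

The product of plans is monotone in its first factor when the second one has an increasing kernel,
and in its second factor when the transpose of the first one does (`planMul_mono_left`,
`planMul_mono_right`). Quantile couplings and their products have both properties. Hence inserting a
time in a product of quantile couplings decreases it (`quantileChain_anti`). The products over
finite sets of times thus form a decreasing net in a relatively compact set of plans, and have a
limit, which is their greatest lower bound (`IsQuantileLimit`). Having an increasing kernel is
equivalent to a family of inequalities between masses of rectangles (`SlopeCondition`). With fixed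
marginals, weak limits preserve the mass of every measurable rectangle, so the limit plan and its
transpose still have increasing kernels.

The limit plans compose correctly (`IsQuantileLimit.planMul_eq`): the monotonicity of the product
gives one inequality, and passing to the limit in one factor at a time gives the other. Kolmogorov's
extension theorem then yields a Markov process with these two-time marginals.

For minimality, the coupling of any Markov process with increasing kernels factorizes along any
finite set of times. Replacing each factor by the quantile coupling increases the product, so the
coupling lies below all products of quantile couplings, hence below their greatest lower bound. Both
uniqueness statements are sandwiches: this bound gives one inequality, and minimality or the limit
property gives the other. A Markov law is determined by its two-time marginals.

If the marginals are stochastically increasing, quantile couplings charge only `x ≤ y`. This passes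
to products and limits, and a process that is almost surely increasing between any two times has a
modification with increasing paths. -/

namespace MarkovQuantile

/-! ### Measures on the line and antitone functions -/

/-- Comparison of two measures on lower sets of the line, from the comparison on closed
half-lines. -/
theorem measure_isLowerSet_le {m m' : Measure ℝ}
    (h : ∀ y, m (Iic y) ≤ m' (Iic y)) {S : Set ℝ} (hS : IsLowerSet S) : m S ≤ m' S := by
  rcases S.eq_empty_or_nonempty with rfl | hne
  · simp
  -- A lower set of the line is a closed half-line, an open one, or the whole line; in each case
  -- closed half-lines with endpoints in the set exhaust it.
  obtain ⟨u, hu, hut, huS⟩ : ∃ u : ℕ → ℝ, Monotone u ∧ (∀ n, u n ∈ S) ∧ ∀ x ∈ S, ∃ n, x ≤ u n := by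
    by_cases hb : BddAbove S
    · by_cases hm : sSup S ∈ S
      · exact ⟨fun _ => sSup S, monotone_const, fun _ => hm, fun x hx => ⟨0, le_csSup hb hx⟩⟩
      · obtain ⟨u, hu, hlt, hlim⟩ := exists_seq_strictMono_tendsto (sSup S)
        have hlt' : ∀ x, x < sSup S → x ∈ S := fun x hx => by
          obtain ⟨y, hy, hxy⟩ := exists_lt_of_lt_csSup hne hx
          exact hS hxy.le hy
        refine ⟨u, hu.monotone, fun n => hlt' _ (hlt n), fun x hx => ?_⟩
        have : x < sSup S := lt_of_le_of_ne (le_csSup hb hx) (fun e => hm (e ▸ hx))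
        obtain ⟨n, hn⟩ := (hlim.eventually (lt_mem_nhds this)).exists
        exact ⟨n, hn.le⟩
    · have huniv : ∀ x, x ∈ S := fun x => by
        obtain ⟨y, hy, hxy⟩ := not_bddAbove_iff.1 hb x
        exact hS hxy.le hy
      exact ⟨fun n => n, Nat.mono_cast, fun n => huniv _, fun x _ => exists_nat_ge x⟩
  have hU : S = ⋃ n, Iic (u n) := by
    ext x
    simp only [mem_iUnion, mem_Iic]
    exact ⟨huS x, fun ⟨n, hn⟩ => hS hn (hut n)⟩
  have hmono : Monotone fun n => Iic (u n) := fun a b hab => Iic_subset_Iic.2 (hu hab)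
  rw [hU, hmono.measure_iUnion, hmono.measure_iUnion]
  exact iSup_mono fun n => h _

/-- If `m` is smaller than `m'` on closed half-lines, integrals of antitone functions compare. -/
theorem lintegral_antitone_le {m m' : Measure ℝ} (h : ∀ y, m (Iic y) ≤ m' (Iic y))
    {G : ℝ → ℝ≥0∞} (hG : Antitone G) (hG1 : ∀ x, G x ≤ 1) :
    ∫⁻ x, G x ∂m ≤ ∫⁻ x, G x ∂m' := by
  have hfin : ∀ x, G x ≠ ∞ := fun x => ((hG1 x).trans_lt ENNReal.one_lt_top).ne
  have hr : Antitone fun x => (G x).toReal := fun x y hxy =>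
    ENNReal.toReal_mono (hfin _) (hG hxy)
  -- Layer-cake formula: the superlevel sets of an antitone function are lower sets.
  have key : ∀ m : Measure ℝ, ∫⁻ x, G x ∂m = ∫⁻ t : ℝ in Ioi 0, m {a | t < (G a).toReal} := by
    intro m
    rw [← lintegral_eq_lintegral_meas_lt m (Eventually.of_forall fun x => ENNReal.toReal_nonneg)
      hr.measurable.aemeasurable]
    exact lintegral_congr fun x => (ENNReal.ofReal_toReal (hfin x)).symm
  rw [key, key]
  refine lintegral_mono fun t => measure_isLowerSet_le h ?_
  intro a b hba ha
  exact lt_of_lt_of_le (show t < (G a).toReal from ha) (hr hba)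

/-- Two finite measures on the plane agree if they agree on quadrants. -/
theorem measure_ext_quadrant {π π' : Measure (ℝ × ℝ)} [IsFiniteMeasure π]
    (h : ∀ x y, π (Iic x ×ˢ Iic y) = π' (Iic x ×ˢ Iic y)) : π = π' := by
  have step1 : ∀ (y : ℝ) (A : Set ℝ), MeasurableSet A → π (A ×ˢ Iic y) = π' (A ×ˢ Iic y) := by
    intro y A hA
    have e : ∀ (ρ : Measure (ℝ × ℝ)) (A : Set ℝ), MeasurableSet A →
        ((ρ.restrict (univ ×ˢ Iic y)).map Prod.fst) A = ρ (A ×ˢ Iic y) := fun ρ A hA => by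
      rw [Measure.map_apply measurable_fst hA, Measure.restrict_apply (measurable_fst hA)]
      congr 1; ext p; simp
    rw [← e π A hA, ← e π' A hA]
    congr 1
    exact Measure.ext_of_Iic _ _ fun x => by
      rw [e _ _ measurableSet_Iic, e _ _ measurableSet_Iic, h]
  refine Measure.ext_prod fun {A B} hA hB => ?_
  have e : ∀ (ρ : Measure (ℝ × ℝ)) (B : Set ℝ), MeasurableSet B →
      ((ρ.restrict (A ×ˢ univ)).map Prod.snd) B = ρ (A ×ˢ B) := fun ρ B hB => by
    rw [Measure.map_apply measurable_snd hB, Measure.restrict_apply (measurable_snd hB)]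
    congr 1; ext p; simp [and_comm]
  rw [← e π B hB, ← e π' B hB]
  congr 1
  exact Measure.ext_of_Iic _ _ fun x => by
    rw [e _ _ measurableSet_Iic, e _ _ measurableSet_Iic, step1 _ _ hA]

/-- A right-continuity principle: the comparison of distribution functions at rational points
implies the stochastic order. -/
theorem stoLE_of_rat {ν ν' : Measure ℝ} [IsFiniteMeasure ν]
    (h : ∀ q : ℚ, ν' (Iic (q : ℝ)) ≤ ν (Iic (q : ℝ))) : StoLE ν ν' := by
  intro x
  have hI : Iic x = ⋂ q : {q : ℚ // x < q}, Iic ((q : ℚ) : ℝ) := by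
    ext y
    simp only [mem_iInter, mem_Iic, Subtype.forall]
    refine ⟨fun hy q hq => hy.trans hq.le, fun hy => ?_⟩
    by_contra hxy
    obtain ⟨q, hq1, hq2⟩ := exists_rat_btwn (not_le.1 hxy)
    exact absurd (hy q hq1) (not_le.2 hq2)
  have : Nonempty {q : ℚ // x < q} := let ⟨q, hq⟩ := exists_rat_gt x; ⟨⟨q, hq⟩⟩
  have hdir : Directed (· ⊇ ·) fun q : {q : ℚ // x < q} => Iic ((q : ℚ) : ℝ) := by
    intro a b
    rcases le_total (a : ℚ) b with hab | hab
    · exact ⟨a, subset_rfl, Iic_subset_Iic.2 (by exact_mod_cast hab)⟩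
    · exact ⟨b, Iic_subset_Iic.2 (by exact_mod_cast hab), subset_rfl⟩
  calc ν' (Iic x) ≤ ⨅ q : {q : ℚ // x < q}, ν (Iic ((q : ℚ) : ℝ)) :=
        le_iInf fun q => (measure_mono (Iic_subset_Iic.2 q.2.le)).trans (h q)
    _ = ν (Iic x) := by
        rw [hI, hdir.measure_iInter (fun q => measurableSet_Iic.nullMeasurableSet)
          ⟨Classical.arbitrary _, measure_ne_top _ _⟩]

/-! ### Transport plans -/

/-- The lower orthant order on transport plans. -/
def OrthLE (π ρ : ProbabilityMeasure (ℝ × ℝ)) : Prop :=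
  ∀ x y : ℝ, (π : Measure (ℝ × ℝ)) (Iic x ×ˢ Iic y) ≤ (ρ : Measure (ℝ × ℝ)) (Iic x ×ˢ Iic y)

theorem OrthLE.refl (π : ProbabilityMeasure (ℝ × ℝ)) : OrthLE π π := fun _ _ => le_rfl

theorem OrthLE.trans {π ρ σ : ProbabilityMeasure (ℝ × ℝ)} (h : OrthLE π ρ) (h' : OrthLE ρ σ) :
    OrthLE π σ := fun x y => (h x y).trans (h' x y)

theorem OrthLE.antisymm {π ρ : ProbabilityMeasure (ℝ × ℝ)} (h : OrthLE π ρ) (h' : OrthLE ρ π) :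
    π = ρ :=
  Subtype.ext (measure_ext_quadrant (π := (π : Measure (ℝ × ℝ)))
    fun x y => le_antisymm (h x y) (h' x y))

theorem plan_ext {π ρ : ProbabilityMeasure (ℝ × ℝ)}
    (h : ∀ x y : ℝ, (π : Measure (ℝ × ℝ)) (Iic x ×ˢ Iic y)
      = (ρ : Measure (ℝ × ℝ)) (Iic x ×ˢ Iic y)) : π = ρ :=
  OrthLE.antisymm (fun x y => (h x y).le) (fun x y => (h x y).ge)

/-- The transposed plan. -/
noncomputable def transpose (π : ProbabilityMeasure (ℝ × ℝ)) : ProbabilityMeasure (ℝ × ℝ) :=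
  π.map (f := Prod.swap) measurable_swap.aemeasurable

theorem coe_transpose (π : ProbabilityMeasure (ℝ × ℝ)) :
    (transpose π : Measure (ℝ × ℝ)) = (π : Measure (ℝ × ℝ)).map Prod.swap := rfl

@[simp] theorem transpose_transpose (π : ProbabilityMeasure (ℝ × ℝ)) :
    transpose (transpose π) = π := by
  apply Subtype.ext
  change ((transpose π : Measure (ℝ × ℝ))).map Prod.swap = _
  rw [coe_transpose, Measure.map_map measurable_swap measurable_swap]
  simp [Measure.map_id]

@[simp] theorem transpose_fst (π : ProbabilityMeasure (ℝ × ℝ)) :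
    (transpose π : Measure (ℝ × ℝ)).fst = (π : Measure (ℝ × ℝ)).snd := by
  rw [coe_transpose, Measure.fst_map_swap]

@[simp] theorem transpose_snd (π : ProbabilityMeasure (ℝ × ℝ)) :
    (transpose π : Measure (ℝ × ℝ)).snd = (π : Measure (ℝ × ℝ)).fst := by
  rw [coe_transpose, Measure.snd_map_swap]

theorem transpose_prod (π : ProbabilityMeasure (ℝ × ℝ)) {A B : Set ℝ} (hA : MeasurableSet A)
    (hB : MeasurableSet B) :
    (transpose π : Measure (ℝ × ℝ)) (A ×ˢ B) = (π : Measure (ℝ × ℝ)) (B ×ˢ A) := by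
  rw [coe_transpose, Measure.map_apply measurable_swap (hA.prod hB), preimage_swap_prod]

theorem OrthLE.transpose {π ρ : ProbabilityMeasure (ℝ × ℝ)} (h : OrthLE π ρ) :
    OrthLE (transpose π) (transpose ρ) := fun x y => by
  rw [transpose_prod _ measurableSet_Iic measurableSet_Iic,
    transpose_prod _ measurableSet_Iic measurableSet_Iic]
  exact h y x

/-! ### The kernel of a plan -/

theorem prod_eq_setLIntegral_condKernel (π : ProbabilityMeasure (ℝ × ℝ)) {A B : Set ℝ}
    (hA : MeasurableSet A) (hB : MeasurableSet B) :
    (π : Measure (ℝ × ℝ)) (A ×ˢ B)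
      = ∫⁻ x in A, (π : Measure (ℝ × ℝ)).condKernel x B ∂(π : Measure (ℝ × ℝ)).fst := by
  conv_lhs => rw [← (π : Measure (ℝ × ℝ)).disintegrate (π : Measure (ℝ × ℝ)).condKernel]
  exact Measure.compProd_apply_prod hA hB

theorem condKernel_ae_eq {π : ProbabilityMeasure (ℝ × ℝ)} {ν : Measure ℝ} [IsFiniteMeasure ν]
    {k : Kernel ℝ ℝ} [IsMarkovKernel k] (h : (π : Measure (ℝ × ℝ)) = ν ⊗ₘ k) :
    ∀ᵐ x ∂ν, k x = (π : Measure (ℝ × ℝ)).condKernel x := by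
  have hf : (π : Measure (ℝ × ℝ)).fst = ν := by rw [h, Measure.fst_compProd]
  have := eq_condKernel_of_measure_eq_compProd (ρ := (π : Measure (ℝ × ℝ))) k (by rw [hf]; exact h)
  rwa [hf] at this

/-- The conditional distribution functions of an increasing kernel are antitone functions of the
starting point, on a measurable set of full measure. -/
theorem HasIncreasingKernel.exists_antitone {π : ProbabilityMeasure (ℝ × ℝ)}
    (h : HasIncreasingKernel π) :
    ∃ E : Set ℝ, MeasurableSet E ∧ (∀ᵐ x ∂(π : Measure (ℝ × ℝ)).fst, x ∈ E) ∧
      ∀ z, ∃ G : ℝ → ℝ≥0∞, Antitone G ∧ (∀ x, G x ≤ 1) ∧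
        ∀ x ∈ E, (π : Measure (ℝ × ℝ)).condKernel x (Iic z) = G x := by
  obtain ⟨k, hk, hπ, E, hE, hmono⟩ := h
  have hae := condKernel_ae_eq (π := π) hπ.symm
  have hN : ∀ᵐ x ∂(π : Measure (ℝ × ℝ)).fst,
      x ∈ E ∧ k x = (π : Measure (ℝ × ℝ)).condKernel x := by
    filter_upwards [hae, compl_mem_ae_iff.2 hE] with x h1 h2
    exact ⟨by simpa using h2, h1⟩
  -- The exceptional set is enlarged to a measurable null set, so that its complement can serve as
  -- `E`.
  obtain ⟨S, hS, hSm, hS0⟩ := exists_measurable_superset_of_null hN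
  refine ⟨Sᶜ, hSm.compl, measure_eq_zero_iff_ae_notMem.1 hS0, fun z => ?_⟩
  have hmem : ∀ x ∈ Sᶜ, x ∈ E ∧ k x = (π : Measure (ℝ × ℝ)).condKernel x := fun x hx => by
    by_contra hc; exact hx (hS hc)
  -- The least antitone function above the conditional distribution function on the good set; it
  -- coincides with it there by monotonicity.
  refine ⟨fun x => ⨆ y ∈ Sᶜ ∩ Ici x, k y (Iic z), ?_, ?_, ?_⟩
  · intro a b hab
    exact biSup_mono fun y hy => ⟨hy.1, le_trans hab hy.2⟩
  · exact fun x => iSup₂_le fun y _ => prob_le_one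
  · intro x hx
    rw [← (hmem x hx).2]
    refine le_antisymm (le_iSup₂_of_le x ⟨hx, self_mem_Ici⟩ le_rfl) (iSup₂_le fun y hy => ?_)
    exact hmono x (hmem x hx).1 y (hmem y hy.1).1 hy.2 z

/-! ### Products of plans -/

theorem coe_planMul (π ρ : ProbabilityMeasure (ℝ × ℝ)) :
    (planMul π ρ : Measure (ℝ × ℝ)) = (π : Measure (ℝ × ℝ)).fst ⊗ₘ
      ((ρ : Measure (ℝ × ℝ)).condKernel ∘ₖ (π : Measure (ℝ × ℝ)).condKernel) := rfl

@[simp] theorem planMul_fst (π ρ : ProbabilityMeasure (ℝ × ℝ)) :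
    (planMul π ρ : Measure (ℝ × ℝ)).fst = (π : Measure (ℝ × ℝ)).fst := by
  rw [coe_planMul, Measure.fst_compProd]

theorem planMul_prod (π ρ : ProbabilityMeasure (ℝ × ℝ)) {A B : Set ℝ} (hA : MeasurableSet A)
    (hB : MeasurableSet B) :
    (planMul π ρ : Measure (ℝ × ℝ)) (A ×ˢ B) =
      ∫⁻ p in A ×ˢ univ, (ρ : Measure (ℝ × ℝ)).condKernel p.2 B ∂(π : Measure (ℝ × ℝ)) := by
  rw [coe_planMul, Measure.compProd_apply_prod hA hB,
    ← Measure.setLIntegral_condKernel (ρ := (π : Measure (ℝ × ℝ)))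
      (f := fun p => (ρ : Measure (ℝ × ℝ)).condKernel p.2 B)
      ((Kernel.measurable_coe _ hB).comp measurable_snd) hA MeasurableSet.univ]
  simp_rw [Kernel.comp_apply' _ _ _ hB, Measure.restrict_univ]

theorem setLIntegral_snd (π : Measure (ℝ × ℝ)) {A : Set ℝ}
    {f : ℝ → ℝ≥0∞} (hf : Measurable f) :
    ∫⁻ p in A ×ˢ univ, f p.2 ∂π = ∫⁻ y, f y ∂((π.restrict (A ×ˢ univ)).map Prod.snd) :=
  (lintegral_map hf measurable_snd).symm

theorem restrict_map_snd_apply (π : Measure (ℝ × ℝ)) {A B : Set ℝ}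
    (hB : MeasurableSet B) : ((π.restrict (A ×ˢ univ)).map Prod.snd) B = π (A ×ˢ B) := by
  rw [Measure.map_apply measurable_snd hB, Measure.restrict_apply (measurable_snd hB)]
  congr 1; ext p; simp [and_comm]

/-- Kernels are known only almost everywhere for the first marginal of the second plan. This
domination lets such identities be used under the integrals that express a product of plans. -/
theorem restrict_map_snd_absolutelyContinuous (π : Measure (ℝ × ℝ)) (A : Set ℝ) :
    (π.restrict (A ×ˢ univ)).map Prod.snd ≪ π.snd :=
  (Measure.absolutelyContinuous_of_le Measure.restrict_le_self).map measurable_snd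

/-- In a product the two endpoints are conditionally independent given the middle point.
Conditioning on the middle point makes the roles of past and future symmetric, which is the source
of the rule for transposes. -/
theorem planMul_prod_eq_lintegral (π ρ : ProbabilityMeasure (ℝ × ℝ)) {A B : Set ℝ}
    (hA : MeasurableSet A) (hB : MeasurableSet B) :
    (planMul π ρ : Measure (ℝ × ℝ)) (A ×ˢ B) =
      ∫⁻ y, (transpose π : Measure (ℝ × ℝ)).condKernel y A * (ρ : Measure (ℝ × ℝ)).condKernel y B
        ∂(π : Measure (ℝ × ℝ)).snd := by
  have hm : Measurable fun y => (ρ : Measure (ℝ × ℝ)).condKernel y B := Kernel.measurable_coe _ hB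
  have hm1 : Measurable fun p : ℝ × ℝ => (ρ : Measure (ℝ × ℝ)).condKernel p.1 B :=
    hm.comp measurable_fst
  have e1 : ∫⁻ p in A ×ˢ univ, (ρ : Measure (ℝ × ℝ)).condKernel p.2 B ∂(π : Measure (ℝ × ℝ))
      = ∫⁻ p in univ ×ˢ A, (ρ : Measure (ℝ × ℝ)).condKernel p.1 B
          ∂(transpose π : Measure (ℝ × ℝ)) := by
    rw [coe_transpose, setLIntegral_map (MeasurableSet.univ.prod hA) hm1 measurable_swap,
      preimage_swap_prod]
    rfl
  rw [planMul_prod π ρ hA hB, e1, ← Measure.setLIntegral_condKernel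
    (ρ := (transpose π : Measure (ℝ × ℝ))) hm1 MeasurableSet.univ hA,
    Measure.restrict_univ, transpose_fst]
  refine lintegral_congr fun y => ?_
  simp [mul_comm]

theorem planMul_snd {π ρ : ProbabilityMeasure (ℝ × ℝ)}
    (h : (π : Measure (ℝ × ℝ)).snd = (ρ : Measure (ℝ × ℝ)).fst) :
    (planMul π ρ : Measure (ℝ × ℝ)).snd = (ρ : Measure (ℝ × ℝ)).snd := by
  ext B hB
  have e : ∀ σ : Measure (ℝ × ℝ), σ.snd B = σ (univ ×ˢ B) := fun σ => by
    rw [Measure.snd_apply hB, univ_prod]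
  rw [e, e, planMul_prod_eq_lintegral π ρ MeasurableSet.univ hB,
    prod_eq_setLIntegral_condKernel ρ MeasurableSet.univ hB, h]
  simp

theorem transpose_planMul {π ρ : ProbabilityMeasure (ℝ × ℝ)}
    (h : (π : Measure (ℝ × ℝ)).snd = (ρ : Measure (ℝ × ℝ)).fst) :
    transpose (planMul π ρ) = planMul (transpose ρ) (transpose π) := by
  refine plan_ext fun x y => ?_
  rw [transpose_prod _ measurableSet_Iic measurableSet_Iic,
    planMul_prod_eq_lintegral _ _ measurableSet_Iic measurableSet_Iic,
    planMul_prod_eq_lintegral _ _ measurableSet_Iic measurableSet_Iic, transpose_transpose,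
    transpose_snd, h]
  exact lintegral_congr fun y => mul_comm _ _

theorem condKernel_planMul (π ρ : ProbabilityMeasure (ℝ × ℝ)) :
    ∀ᵐ x ∂(π : Measure (ℝ × ℝ)).fst,
      ((ρ : Measure (ℝ × ℝ)).condKernel ∘ₖ (π : Measure (ℝ × ℝ)).condKernel) x
        = (planMul π ρ : Measure (ℝ × ℝ)).condKernel x :=
  condKernel_ae_eq (coe_planMul π ρ)

theorem lintegral_planMul (π ρ : ProbabilityMeasure (ℝ × ℝ)) {A : Set ℝ} (hA : MeasurableSet A)
    {f : ℝ → ℝ≥0∞} (hf : Measurable f) :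
    ∫⁻ p in A ×ˢ univ, f p.2 ∂(planMul π ρ : Measure (ℝ × ℝ)) =
      ∫⁻ p in A ×ˢ univ, (∫⁻ z, f z ∂(ρ : Measure (ℝ × ℝ)).condKernel p.2)
        ∂(π : Measure (ℝ × ℝ)) := by
  rw [coe_planMul, Measure.setLIntegral_compProd (f := fun p => f p.2) (hf.comp measurable_snd) hA MeasurableSet.univ,
    ← Measure.setLIntegral_condKernel (ρ := (π : Measure (ℝ × ℝ)))
      (f := fun p => ∫⁻ z, f z ∂(ρ : Measure (ℝ × ℝ)).condKernel p.2)
      (hf.lintegral_kernel.comp measurable_snd) hA MeasurableSet.univ]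
  simp_rw [Measure.restrict_univ]
  refine lintegral_congr fun x => ?_
  rw [Kernel.lintegral_comp _ _ _ hf]

theorem planMul_assoc {π ρ σ : ProbabilityMeasure (ℝ × ℝ)}
    (h : (π : Measure (ℝ × ℝ)).snd = (ρ : Measure (ℝ × ℝ)).fst) :
    planMul (planMul π ρ) σ = planMul π (planMul ρ σ) := by
  refine plan_ext fun x z => ?_
  have hm : Measurable fun y => (σ : Measure (ℝ × ℝ)).condKernel y (Iic z) :=
    Kernel.measurable_coe _ measurableSet_Iic
  rw [planMul_prod _ _ measurableSet_Iic measurableSet_Iic,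
    planMul_prod _ _ measurableSet_Iic measurableSet_Iic,
    lintegral_planMul π ρ measurableSet_Iic hm,
    setLIntegral_snd _ hm.lintegral_kernel,
    setLIntegral_snd _ (Kernel.measurable_coe _ measurableSet_Iic)]
  refine lintegral_congr_ae ((restrict_map_snd_absolutelyContinuous _ _).ae_le ?_)
  rw [h]
  filter_upwards [condKernel_planMul ρ σ] with y hy
  rw [← hy, Kernel.comp_apply' _ _ _ measurableSet_Iic]

/-- The product of plans is monotone in its first factor if the second one has an increasing
kernel. -/
theorem planMul_mono_left {π π' ρ : ProbabilityMeasure (ℝ × ℝ)}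
    (h : (π : Measure (ℝ × ℝ)).snd = (ρ : Measure (ℝ × ℝ)).fst)
    (h' : (π' : Measure (ℝ × ℝ)).snd = (ρ : Measure (ℝ × ℝ)).fst)
    (hρ : HasIncreasingKernel ρ) (hle : OrthLE π π') :
    OrthLE (planMul π ρ) (planMul π' ρ) := by
  intro x z
  obtain ⟨E, hEm, hE, hG⟩ := hρ.exists_antitone
  obtain ⟨G, hGa, hG1, hGE⟩ := hG z
  have key : ∀ σ : ProbabilityMeasure (ℝ × ℝ),
      (σ : Measure (ℝ × ℝ)).snd = (ρ : Measure (ℝ × ℝ)).fst →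
      (planMul σ ρ : Measure (ℝ × ℝ)) (Iic x ×ˢ Iic z) =
        ∫⁻ y, G y ∂(((σ : Measure (ℝ × ℝ)).restrict (Iic x ×ˢ univ)).map Prod.snd) := by
    intro σ hσ
    rw [planMul_prod _ _ measurableSet_Iic measurableSet_Iic,
      setLIntegral_snd _ (Kernel.measurable_coe _ measurableSet_Iic)]
    refine lintegral_congr_ae ((restrict_map_snd_absolutelyContinuous _ _).ae_le ?_)
    rw [hσ]
    filter_upwards [hE] with y hy using hGE y hy
  rw [key π h, key π' h']
  refine lintegral_antitone_le (fun y => ?_) hGa hG1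
  rw [restrict_map_snd_apply _ measurableSet_Iic, restrict_map_snd_apply _ measurableSet_Iic]
  exact hle x y

/-- The product of plans is monotone in its second factor if the transpose of the first one has
an increasing kernel. -/
theorem planMul_mono_right {π ρ ρ' : ProbabilityMeasure (ℝ × ℝ)}
    (h : (π : Measure (ℝ × ℝ)).snd = (ρ : Measure (ℝ × ℝ)).fst)
    (h' : (π : Measure (ℝ × ℝ)).snd = (ρ' : Measure (ℝ × ℝ)).fst)
    (hπ : HasIncreasingKernel (transpose π)) (hle : OrthLE ρ ρ') :
    OrthLE (planMul π ρ) (planMul π ρ') := by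
  have := (planMul_mono_left (by simp [h]) (by simp [h']) hπ hle.transpose).transpose
  rwa [← transpose_planMul h, ← transpose_planMul h', transpose_transpose,
    transpose_transpose] at this

/-- Integrating an antitone function against a stochastically increasing family of laws gives an
antitone function of the parameter. -/
theorem HasIncreasingKernel.planMul {π ρ : ProbabilityMeasure (ℝ × ℝ)}
    (h : (π : Measure (ℝ × ℝ)).snd = (ρ : Measure (ℝ × ℝ)).fst)
    (hπ : HasIncreasingKernel π) (hρ : HasIncreasingKernel ρ) :
    HasIncreasingKernel (planMul π ρ) := by
  obtain ⟨E, hEm, hE, hG⟩ := hπ.exists_antitone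
  obtain ⟨E', hEm', hE', hG'⟩ := hρ.exists_antitone
  refine ⟨(ρ : Measure (ℝ × ℝ)).condKernel ∘ₖ (π : Measure (ℝ × ℝ)).condKernel, inferInstance,
    by rw [planMul_fst, coe_planMul],
    -- The second condition allows the conditional distribution functions of `ρ` to be replaced by
    -- antitone functions under the kernel of `π` at `x`.
    {x | x ∈ E ∧ ∀ᵐ y ∂(π : Measure (ℝ × ℝ)).condKernel x, y ∈ E'}, ?_, ?_⟩
  · rw [planMul_fst]
    have h1 : ∀ᵐ p ∂(π : Measure (ℝ × ℝ)).fst ⊗ₘ (π : Measure (ℝ × ℝ)).condKernel, p.2 ∈ E' := by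
      rw [Measure.disintegrate]
      have : ∀ᵐ y ∂(π : Measure (ℝ × ℝ)).snd, y ∈ E' := by
        rwa [h]
      exact ae_of_ae_map measurable_snd.aemeasurable this
    have h2 := Measure.ae_ae_of_ae_compProd h1
    exact hE.and h2
  · rintro x ⟨hx, hx'⟩ y ⟨hy, hy'⟩ hxy z
    obtain ⟨G, hGa, hG1, hGE⟩ := hG' z
    have key : ∀ x, (∀ᵐ y ∂(π : Measure (ℝ × ℝ)).condKernel x, y ∈ E') →
        ((ρ : Measure (ℝ × ℝ)).condKernel ∘ₖ (π : Measure (ℝ × ℝ)).condKernel) x (Iic z)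
          = ∫⁻ y, G y ∂(π : Measure (ℝ × ℝ)).condKernel x := by
      intro x hx
      rw [Kernel.comp_apply' _ _ _ measurableSet_Iic]
      refine lintegral_congr_ae ?_
      filter_upwards [hx] with y hy using hGE y hy
    rw [key x hx', key y hy']
    refine lintegral_antitone_le (fun w => ?_) hGa hG1
    obtain ⟨H, hHa, -, hHE⟩ := hG w
    rw [hHE x hx, hHE y hy]
    exact hHa hxy

/-! ### A characterization of increasing kernels by rectangles -/

/-- A plan which puts, relatively to the first marginal, more mass below any level from an interval
than from a later interval. -/
def SlopeCondition (π : ProbabilityMeasure (ℝ × ℝ)) : Prop :=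
  ∀ a b c d z : ℝ, b < c →
    (π : Measure (ℝ × ℝ)) (Icc c d ×ˢ Iic z) * (π : Measure (ℝ × ℝ)) (Icc a b ×ˢ univ) ≤
      (π : Measure (ℝ × ℝ)) (Icc a b ×ˢ Iic z) * (π : Measure (ℝ × ℝ)) (Icc c d ×ˢ univ)

theorem fst_eq_prod_univ (π : Measure (ℝ × ℝ)) {A : Set ℝ} (hA : MeasurableSet A) :
    π.fst A = π (A ×ˢ univ) := by
  rw [Measure.fst_apply hA, prod_univ]

theorem snd_eq_univ_prod (π : Measure (ℝ × ℝ)) {A : Set ℝ} (hA : MeasurableSet A) :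
    π.snd A = π (univ ×ˢ A) := by
  rw [Measure.snd_apply hA, univ_prod]

/-- The value at `b` of the antitone version separates its averages over the two intervals. -/
theorem HasIncreasingKernel.slopeCondition {π : ProbabilityMeasure (ℝ × ℝ)}
    (h : HasIncreasingKernel π) : SlopeCondition π := by
  obtain ⟨E, hEm, hE, hG⟩ := h.exists_antitone
  intro a b c d z hbc
  obtain ⟨G, hGa, hG1, hGE⟩ := hG z
  have key : ∀ A : Set ℝ, MeasurableSet A → (π : Measure (ℝ × ℝ)) (A ×ˢ Iic z) =
      ∫⁻ x in A, G x ∂(π : Measure (ℝ × ℝ)).fst := by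
    intro A hA
    rw [prod_eq_setLIntegral_condKernel π hA measurableSet_Iic]
    refine lintegral_congr_ae (ae_restrict_of_ae ?_)
    filter_upwards [hE] with y hy using hGE y hy
  rw [key _ measurableSet_Icc, key _ measurableSet_Icc, ← fst_eq_prod_univ _ measurableSet_Icc,
    ← fst_eq_prod_univ _ measurableSet_Icc]
  have h1 : ∫⁻ x in Icc c d, G x ∂(π : Measure (ℝ × ℝ)).fst
      ≤ G b * (π : Measure (ℝ × ℝ)).fst (Icc c d) := by
    rw [← setLIntegral_const]
    exact setLIntegral_mono' measurableSet_Icc fun x hx => hGa (hbc.le.trans hx.1)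
  have h2 : G b * (π : Measure (ℝ × ℝ)).fst (Icc a b)
      ≤ ∫⁻ x in Icc a b, G x ∂(π : Measure (ℝ × ℝ)).fst := by
    rw [← setLIntegral_const]
    exact setLIntegral_mono' measurableSet_Icc fun x hx => hGa hx.2
  calc _ ≤ G b * (π : Measure (ℝ × ℝ)).fst (Icc c d) * (π : Measure (ℝ × ℝ)).fst (Icc a b) := by
        gcongr
    _ = G b * (π : Measure (ℝ × ℝ)).fst (Icc a b) * (π : Measure (ℝ × ℝ)).fst (Icc c d) := by
        ring
    _ ≤ _ := by gcongr

/-- By Besicovitch differentiation, the kernel at almost every point is the limit of averages over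
small balls, and the hypothesis compares the averages over two disjoint balls. Rational levels
suffice, so a single null set is discarded. -/
theorem SlopeCondition.hasIncreasingKernel {π : ProbabilityMeasure (ℝ × ℝ)}
    (h : SlopeCondition π) : HasIncreasingKernel π := by
  set ν := (π : Measure (ℝ × ℝ)).fst with hν
  set k := (π : Measure (ℝ × ℝ)).condKernel with hk
  set v := Besicovitch.vitaliFamily ν
  have hlim : ∀ᵐ x ∂ν, ∀ q : ℚ, Tendsto (fun a => (∫⁻ y in a, k y (Iic (q : ℝ)) ∂ν) / ν a)
      (v.filterAt x) (𝓝 (k x (Iic (q : ℝ)))) := by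
    rw [ae_all_iff]
    intro q
    refine v.ae_tendsto_lintegral_div (Kernel.measurable_coe _ measurableSet_Iic).aemeasurable ?_
    refine ((lintegral_mono fun y => (prob_le_one : k y (Iic (q : ℝ)) ≤ 1)).trans_lt ?_).ne
    simp
  have hE := hlim.and v.ae_eventually_measure_pos
  refine ⟨k, inferInstance, Measure.disintegrate _ _,
    {x | (∀ q : ℚ, Tendsto (fun a => (∫⁻ y in a, k y (Iic (q : ℝ)) ∂ν) / ν a)
      (v.filterAt x) (𝓝 (k x (Iic (q : ℝ))))) ∧ ∀ᶠ a in v.filterAt x, 0 < ν a}, hE, ?_⟩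
  rintro x ⟨hx, hx0⟩ y ⟨hy, hy0⟩ hxy
  refine stoLE_of_rat fun q => ?_
  rcases hxy.eq_or_lt with rfl | hlt
  · exact le_rfl
  have tx := Besicovitch.tendsto_filterAt ν x
  have ty := Besicovitch.tendsto_filterAt ν y
  refine le_of_tendsto_of_tendsto ((hy q).comp ty) ((hx q).comp tx) ?_
  -- Below this radius the closed balls around `x` and `y` are disjoint and in the right order.
  have hr : ∀ᶠ r : ℝ in 𝓝[>] 0, r < (y - x) / 2 :=
    mem_nhdsWithin_of_mem_nhds (gt_mem_nhds (by linarith))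
  filter_upwards [hr, tx.eventually hx0, ty.eventually hy0] with r hr1 hr2 hr3
  have := h (x - r) (x + r) (y - r) (y + r) q (by linarith)
  rw [← Real.closedBall_eq_Icc, ← Real.closedBall_eq_Icc] at this
  rw [prod_eq_setLIntegral_condKernel π Metric.isClosed_closedBall.measurableSet measurableSet_Iic,
    prod_eq_setLIntegral_condKernel π Metric.isClosed_closedBall.measurableSet measurableSet_Iic,
    ← fst_eq_prod_univ _ Metric.isClosed_closedBall.measurableSet,
    ← fst_eq_prod_univ _ Metric.isClosed_closedBall.measurableSet, ← hν, ← hk] at this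
  simp only [Function.comp_apply]
  rw [ENNReal.div_le_iff hr3.ne' (measure_ne_top _ _), div_eq_mul_inv, mul_right_comm,
    ← div_eq_mul_inv, ENNReal.le_div_iff_mul_le (Or.inl hr2.ne') (Or.inl (measure_ne_top _ _))]
  exact this

/-! ### Quantile couplings -/

/-- Right continuity of the distribution function makes the infimum attained. -/
theorem quantileFun_le_iff (ν : ProbabilityMeasure ℝ) {q : ℝ} (hq : q ∈ Ioo (0 : ℝ) 1) (x : ℝ) :
    quantileFun ν q ≤ x ↔ q ≤ cdf (ν : Measure ℝ) x := by
  constructor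
  · intro h
    have hne : {x : ℝ | q ≤ cdf (ν : Measure ℝ) x}.Nonempty := by
      obtain ⟨m, hm⟩ := ((tendsto_cdf_atTop (ν : Measure ℝ)).eventually
        (lt_mem_nhds hq.2)).exists
      exact ⟨m, hm.le⟩
    have hc : Tendsto (cdf (ν : Measure ℝ)) (𝓝[>] x) (𝓝 (cdf (ν : Measure ℝ) x)) :=
      ((cdf (ν : Measure ℝ)).right_continuous x).tendsto.mono_left
        (nhdsWithin_mono x Ioi_subset_Ici_self)
    refine ge_of_tendsto hc ?_
    filter_upwards [self_mem_nhdsWithin] with y hy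
    obtain ⟨z, hz, hzy⟩ := exists_lt_of_csInf_lt hne (lt_of_le_of_lt h hy)
    exact le_trans hz (monotone_cdf _ hzy.le)
  · intro h
    refine csInf_le ?_ h
    obtain ⟨m, hm⟩ := ((tendsto_cdf_atBot (ν : Measure ℝ)).eventually
      (gt_mem_nhds hq.1)).exists
    refine ⟨m, fun y hy => ?_⟩
    by_contra hlt
    have h1 := monotone_cdf (ν : Measure ℝ) (not_le.mp hlt).le
    have h2 : q ≤ cdf (ν : Measure ℝ) y := hy
    linarith

theorem coe_quantileCoupling (ν ν' : ProbabilityMeasure ℝ) :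
    (quantileCoupling ν ν' : Measure (ℝ × ℝ)) = (volume.restrict (Ioo (0 : ℝ) 1)).map
      (fun q => (quantileFun ν q, quantileFun ν' q)) := rfl

theorem quantileCoupling_prod (ν ν' : ProbabilityMeasure ℝ) {A B : Set ℝ} (hA : MeasurableSet A)
    (hB : MeasurableSet B) :
    (quantileCoupling ν ν' : Measure (ℝ × ℝ)) (A ×ˢ B) =
      volume ({q | quantileFun ν q ∈ A ∧ quantileFun ν' q ∈ B} ∩ Ioo (0 : ℝ) 1) := by
  rw [coe_quantileCoupling, Measure.map_apply_of_aemeasurable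
    ((aemeasurable_quantileFun ν).prodMk (aemeasurable_quantileFun ν')) (hA.prod hB),
    Measure.restrict_apply' measurableSet_Ioo]
  rfl

theorem volume_quantileFun_le (ν : ProbabilityMeasure ℝ) (x : ℝ) :
    volume ({q | quantileFun ν q ≤ x} ∩ Ioo (0 : ℝ) 1) = (ν : Measure ℝ) (Iic x) := by
  have hc1 := cdf_le_one (ν : Measure ℝ) x
  have e : {q | quantileFun ν q ≤ x} ∩ Ioo (0 : ℝ) 1 = Iic (cdf (ν : Measure ℝ) x) ∩ Ioo 0 1 := by
    ext q
    exact ⟨fun h => ⟨(quantileFun_le_iff ν h.2 x).1 h.1, h.2⟩,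
      fun h => ⟨(quantileFun_le_iff ν h.2 x).2 h.1, h.2⟩⟩
  rw [e, ← ofReal_cdf]
  refine le_antisymm ?_ ?_
  · calc _ ≤ volume (Ioc 0 (cdf (ν : Measure ℝ) x)) := by
          refine measure_mono fun q h => ?_
          exact ⟨h.2.1, h.1⟩
      _ = _ := by simp
  · calc _ = volume (Ioo 0 (cdf (ν : Measure ℝ) x)) := by simp
      _ ≤ _ := by
          refine measure_mono fun q h => ?_
          exact ⟨h.2.le, h.1, h.2.trans_le hc1⟩

@[simp] theorem quantileCoupling_fst (ν ν' : ProbabilityMeasure ℝ) :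
    (quantileCoupling ν ν' : Measure (ℝ × ℝ)).fst = (ν : Measure ℝ) := by
  refine Measure.ext_of_Iic _ _ fun x => ?_
  rw [fst_eq_prod_univ _ measurableSet_Iic,
    quantileCoupling_prod _ _ measurableSet_Iic MeasurableSet.univ, ← volume_quantileFun_le]
  simp

@[simp] theorem quantileCoupling_snd (ν ν' : ProbabilityMeasure ℝ) :
    (quantileCoupling ν ν' : Measure (ℝ × ℝ)).snd = (ν' : Measure ℝ) := by
  refine Measure.ext_of_Iic _ _ fun x => ?_
  rw [snd_eq_univ_prod _ measurableSet_Iic,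
    quantileCoupling_prod _ _ MeasurableSet.univ measurableSet_Iic, ← volume_quantileFun_le]
  simp

theorem transpose_quantileCoupling (ν ν' : ProbabilityMeasure ℝ) :
    transpose (quantileCoupling ν ν') = quantileCoupling ν' ν :=
  plan_ext fun x y => by
    rw [transpose_prod _ measurableSet_Iic measurableSet_Iic,
      quantileCoupling_prod _ _ measurableSet_Iic measurableSet_Iic,
      quantileCoupling_prod _ _ measurableSet_Iic measurableSet_Iic]
    simp_rw [and_comm]

/-- The quantile coupling is the greatest coupling for the lower orthant order. -/
theorem orthLE_quantileCoupling {ν ν' : ProbabilityMeasure ℝ} {π : ProbabilityMeasure (ℝ × ℝ)}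
    (h : (π : Measure (ℝ × ℝ)).fst = ν) (h' : (π : Measure (ℝ × ℝ)).snd = ν') :
    OrthLE π (quantileCoupling ν ν') := by
  intro x y
  rw [quantileCoupling_prod _ _ measurableSet_Iic measurableSet_Iic]
  -- Under the quantile coupling the two events are nested, so the quadrant has the smaller of the
  -- two marginal masses, an upper bound for every coupling.
  rcases le_total (cdf (ν : Measure ℝ) x) (cdf (ν' : Measure ℝ) y) with hc | hc
  · calc (π : Measure (ℝ × ℝ)) (Iic x ×ˢ Iic y) ≤ (π : Measure (ℝ × ℝ)) (Iic x ×ˢ univ) := by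
          gcongr; exact subset_univ _
      _ = volume ({q | quantileFun ν q ≤ x} ∩ Ioo (0 : ℝ) 1) := by
          rw [volume_quantileFun_le, ← fst_eq_prod_univ _ measurableSet_Iic, h]
      _ ≤ _ := by
          refine measure_mono fun q hq => ?_
          exact ⟨⟨hq.1, (quantileFun_le_iff ν' hq.2 y).2
            (((quantileFun_le_iff ν hq.2 x).1 hq.1).trans hc)⟩, hq.2⟩
  · calc (π : Measure (ℝ × ℝ)) (Iic x ×ˢ Iic y) ≤ (π : Measure (ℝ × ℝ)) (univ ×ˢ Iic y) := by
          gcongr; exact subset_univ _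
      _ = volume ({q | quantileFun ν' q ≤ y} ∩ Ioo (0 : ℝ) 1) := by
          rw [volume_quantileFun_le, ← snd_eq_univ_prod _ measurableSet_Iic, h']
      _ ≤ _ := by
          refine measure_mono fun q hq => ?_
          exact ⟨⟨(quantileFun_le_iff ν hq.2 x).2
            (((quantileFun_le_iff ν' hq.2 y).1 hq.1).trans hc), hq.1⟩, hq.2⟩

/-- Both coordinates are monotone functions of one parameter. If a parameter in the first slab
exceeds the level `z`, so do all parameters in the later slab, and the left side vanishes. Otherwise
the whole first slab lies below `z`. -/
theorem hasIncreasingKernel_quantileCoupling (ν ν' : ProbabilityMeasure ℝ) :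
    HasIncreasingKernel (quantileCoupling ν ν') := by
  refine SlopeCondition.hasIncreasingKernel fun a b c d z hbc => ?_
  rw [quantileCoupling_prod _ _ measurableSet_Icc measurableSet_Iic,
    quantileCoupling_prod _ _ measurableSet_Icc measurableSet_Iic,
    quantileCoupling_prod _ _ measurableSet_Icc MeasurableSet.univ,
    quantileCoupling_prod _ _ measurableSet_Icc MeasurableSet.univ]
  by_cases hex : ∃ i ∈ Ioo (0 : ℝ) 1, quantileFun ν i ∈ Icc a b ∧ z < quantileFun ν' i
  · obtain ⟨i, hi, hiI, hiz⟩ := hex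
    have : {q | quantileFun ν q ∈ Icc c d ∧ quantileFun ν' q ∈ Iic z} ∩ Ioo (0 : ℝ) 1 = ∅ := by
      rw [eq_empty_iff_forall_notMem]
      rintro j ⟨⟨hj1, hj2⟩, hj⟩
      have hij : i ≤ j := by
        by_contra hlt
        have := monotoneOn_quantileFun ν hj hi (not_le.1 hlt).le
        linarith [hj1.1, hiI.2]
      have := monotoneOn_quantileFun ν' hi hj hij
      exact absurd (hiz.trans_le this) (not_lt.2 hj2)
    rw [this]
    simp
  · push Not at hex
    have : {q | quantileFun ν q ∈ Icc a b ∧ quantileFun ν' q ∈ Iic z} ∩ Ioo (0 : ℝ) 1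
        = {q | quantileFun ν q ∈ Icc a b ∧ quantileFun ν' q ∈ univ} ∩ Ioo (0 : ℝ) 1 := by
      ext q
      exact ⟨fun h => ⟨⟨h.1.1, mem_univ _⟩, h.2⟩, fun h => ⟨⟨h.1.1, hex q h.2 h.1.1⟩, h.2⟩⟩
    rw [this, mul_comm]
    gcongr
    exact subset_univ _

theorem hasIncreasingKernel_transpose_quantileCoupling (ν ν' : ProbabilityMeasure ℝ) :
    HasIncreasingKernel (transpose (quantileCoupling ν ν')) := by
  rw [transpose_quantileCoupling]
  exact hasIncreasingKernel_quantileCoupling _ _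

theorem quantileCoupling_self_prod (ν : ProbabilityMeasure ℝ) {A B : Set ℝ} (hA : MeasurableSet A)
    (hB : MeasurableSet B) :
    (quantileCoupling ν ν : Measure (ℝ × ℝ)) (A ×ˢ B) = (ν : Measure ℝ) (A ∩ B) := by
  have h := quantileCoupling_fst ν ν
  rw [quantileCoupling_prod _ _ hA hB, ← h, fst_eq_prod_univ _ (hA.inter hB),
    quantileCoupling_prod _ _ (hA.inter hB) MeasurableSet.univ]
  congr 1
  ext q
  simp [and_assoc]

/-- The coupling of a law with itself is carried by the diagonal, hence neutral for the product. -/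
theorem quantileCoupling_self_planMul {ν : ProbabilityMeasure ℝ} {π : ProbabilityMeasure (ℝ × ℝ)}
    (h : (π : Measure (ℝ × ℝ)).fst = ν) : planMul (quantileCoupling ν ν) π = π := by
  refine plan_ext fun x z => ?_
  rw [planMul_prod _ _ measurableSet_Iic measurableSet_Iic,
    setLIntegral_snd _ (Kernel.measurable_coe _ measurableSet_Iic),
    prod_eq_setLIntegral_condKernel _ measurableSet_Iic measurableSet_Iic, h]
  congr 1
  ext B hB
  rw [restrict_map_snd_apply _ hB, quantileCoupling_self_prod _ measurableSet_Iic hB,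
    Measure.restrict_apply hB, inter_comm]

theorem planMul_quantileCoupling_self {ν : ProbabilityMeasure ℝ} {π : ProbabilityMeasure (ℝ × ℝ)}
    (h : (π : Measure (ℝ × ℝ)).snd = ν) : planMul π (quantileCoupling ν ν) = π := by
  have h1 := transpose_planMul (π := π) (ρ := quantileCoupling ν ν) (by simp [h])
  rw [transpose_quantileCoupling, quantileCoupling_self_planMul (by simp [h])] at h1
  rw [← transpose_transpose (planMul _ _), h1, transpose_transpose]

/-! ### Products of quantile couplings -/

section Chain

variable (μ : ℝ → ProbabilityMeasure ℝ)

@[simp] theorem quantileChain_fst (t s : ℝ) (l : List ℝ) :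
    (quantileChain μ t s l : Measure (ℝ × ℝ)).fst = μ s := by
  cases l <;> simp [quantileChain]

@[simp] theorem quantileChain_snd (t s : ℝ) (l : List ℝ) :
    (quantileChain μ t s l : Measure (ℝ × ℝ)).snd = μ t := by
  induction l generalizing s with
  | nil => simp [quantileChain]
  | cons r l ih => rw [quantileChain, planMul_snd (by simp), ih]

theorem hasIncreasingKernel_quantileChain (t s : ℝ) (l : List ℝ) :
    HasIncreasingKernel (quantileChain μ t s l) := by
  induction l generalizing s with
  | nil => exact hasIncreasingKernel_quantileCoupling _ _
  | cons r l ih => exact (hasIncreasingKernel_quantileCoupling _ _).planMul (by simp) (ih r)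

theorem hasIncreasingKernel_transpose_quantileChain (t s : ℝ) (l : List ℝ) :
    HasIncreasingKernel (transpose (quantileChain μ t s l)) := by
  induction l generalizing s with
  | nil => exact hasIncreasingKernel_transpose_quantileCoupling _ _
  | cons r l ih =>
    rw [quantileChain, transpose_planMul (by simp)]
    exact (ih r).planMul (by simp) (hasIncreasingKernel_transpose_quantileCoupling _ _)

theorem quantileChain_append (u t s : ℝ) (l l' : List ℝ) :
    quantileChain μ u s (l ++ t :: l')
      = planMul (quantileChain μ t s l) (quantileChain μ u t l') := by
  induction l generalizing s with
  | nil => rfl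
  | cons r l ih => rw [List.cons_append, quantileChain, ih, quantileChain, planMul_assoc (by simp)]

/-- Inserting times in a product of quantile couplings decreases it for the lower orthant order. -/
theorem quantileChain_anti (t : ℝ) {l l' : List ℝ} (h : l.Sublist l') (s : ℝ) :
    OrthLE (quantileChain μ t s l') (quantileChain μ t s l) := by
  induction h generalizing s with
  | slnil => exact OrthLE.refl _
  | @cons l l' a h ih =>
    cases l with
    | nil => exact orthLE_quantileCoupling (by simp) (by simp)
    | cons b l =>
      have h1 : OrthLE (planMul (quantileCoupling (μ s) (μ a)) (quantileChain μ t a l'))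
          (planMul (quantileCoupling (μ s) (μ a)) (quantileChain μ t a (b :: l))) :=
        planMul_mono_right (by simp) (by simp)
          (hasIncreasingKernel_transpose_quantileCoupling _ _) (ih a)
      refine h1.trans ?_
      rw [quantileChain, ← planMul_assoc (by simp)]
      -- After reassociation, the plan from `s` to `b` through `a` is a coupling of the same
      -- marginals, so it lies below the direct quantile coupling.
      refine planMul_mono_left ?_ (by simp) (hasIncreasingKernel_quantileChain μ t b l)
        (orthLE_quantileCoupling (by simp) ?_) <;>
      · rw [planMul_snd (by simp)]; simp
  | @cons_cons l l' a h ih =>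
    exact planMul_mono_right (by simp) (by simp)
      (hasIncreasingKernel_transpose_quantileCoupling _ _) (ih a)

theorem quantileProduct_anti (s t : ℝ) {R R' : Finset ℝ} (h : R ⊆ R') :
    OrthLE (quantileProduct μ s t R') (quantileProduct μ s t R) := by
  refine quantileChain_anti μ t ?_ s
  refine List.sublist_of_subperm_of_sortedLE ?_ (Finset.pairwise_sort R _).sortedLE (Finset.pairwise_sort R' _).sortedLE
  refine (R.sort_nodup _).subperm fun x hx => ?_
  simp only [Finset.mem_sort] at hx ⊢
  exact h hx

theorem sort_union_insert {R R' : Finset ℝ} {t : ℝ} (hR : ∀ r ∈ R, r < t) (hR' : ∀ r ∈ R', t < r) :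
    (R ∪ insert t R').sort (· ≤ ·) = R.sort (· ≤ ·) ++ t :: R'.sort (· ≤ ·) := by
  have hnd : (R.sort (· ≤ ·) ++ t :: R'.sort (· ≤ ·)).Nodup := by
    simp only [List.nodup_append, List.nodup_cons, Finset.sort_nodup, Finset.mem_sort,
      List.mem_cons]
    refine ⟨trivial, ⟨fun h => (hR' t h).false, trivial⟩, fun a ha b hb hab => ?_⟩
    subst hab
    rcases hb with rfl | hb
    · exact (hR a ha).false
    · exact ((hR a ha).trans (hR' a hb)).false
  refine List.Perm.eq_of_sortedLE (Finset.pairwise_sort _ _).sortedLE ?_ ?_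
  · rw [List.sortedLE_iff_pairwise]
    simp only [List.pairwise_append, List.pairwise_cons, Finset.mem_sort, List.mem_cons]
    refine ⟨Finset.pairwise_sort R _, ⟨fun a ha => (hR' a ha).le, Finset.pairwise_sort R' _⟩,
      fun a ha b hb => ?_⟩
    rcases hb with rfl | hb
    · exact (hR a ha).le
    · exact ((hR a ha).trans (hR' b hb)).le
  · rw [List.perm_ext_iff_of_nodup (Finset.sort_nodup _ _) hnd]
    intro a
    simp only [Finset.mem_sort, Finset.mem_union, Finset.mem_insert, List.mem_append, List.mem_cons]

theorem quantileProduct_union_insert {s t u : ℝ} {R R' : Finset ℝ} (hR : ∀ r ∈ R, r < t)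
    (hR' : ∀ r ∈ R', t < r) :
    quantileProduct μ s u (R ∪ insert t R')
      = planMul (quantileProduct μ s t R) (quantileProduct μ t u R') := by
  rw [quantileProduct, sort_union_insert hR hR', quantileChain_append]
  rfl

/-- The endpoints play no role in a product of quantile couplings. -/
theorem quantileProduct_filter_Ioo {s t : ℝ} (hst : s < t) {R : Finset ℝ}
    (hR : (R : Set ℝ) ⊆ Icc s t) :
    quantileProduct μ s t (R.filter (· ∈ Ioo s t)) = quantileProduct μ s t R := by
  classical
  have h0 : ∀ r, quantileProduct μ r r ∅ = quantileCoupling (μ r) (μ r) := fun r => by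
    rw [quantileProduct, Finset.sort_empty, quantileChain]
  have hs : ∀ R : Finset ℝ, (∀ r ∈ R, s < r) →
      quantileProduct μ s t (insert s R) = quantileProduct μ s t R := fun R hR => by
    have := quantileProduct_union_insert μ (s := s) (u := t) (R := ∅) (R' := R) (by simp) hR
    rw [Finset.empty_union] at this
    rw [this, h0, quantileCoupling_self_planMul (by rw [quantileProduct, quantileChain_fst])]
  have ht : ∀ R : Finset ℝ, (∀ r ∈ R, r < t) →
      quantileProduct μ s t (insert t R) = quantileProduct μ s t R := fun R hR => by
    have := quantileProduct_union_insert μ (s := s) (u := t) (R := R) (R' := ∅) hR (by simp)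
    rw [Finset.union_insert, Finset.union_empty] at this
    rw [this, h0, planMul_quantileCoupling_self (by rw [quantileProduct, quantileChain_snd])]
  set R₁ := R.filter (· ∈ Ioo s t) with hR₁
  have hlt : ∀ r ∈ R₁, s < r ∧ r < t := fun r hr => (Finset.mem_filter.1 hr).2
  -- `R` lies between `R₁` and `R₁` with both endpoints added; the extreme products agree, and
  -- monotonicity squeezes the one along `R`.
  have hle : OrthLE (quantileProduct μ s t R) (quantileProduct μ s t R₁) :=
    quantileProduct_anti μ s t (Finset.filter_subset _ _)
  refine OrthLE.antisymm ?_ hle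
  have e : quantileProduct μ s t (insert s (insert t R₁)) = quantileProduct μ s t R₁ := by
    rw [hs, ht _ fun r hr => (hlt r hr).2]
    intro r hr
    rcases Finset.mem_insert.1 hr with rfl | hr
    · exact hst
    · exact (hlt r hr).1
  rw [← e]
  refine quantileProduct_anti μ s t fun r hr => ?_
  have := hR hr
  simp only [Finset.mem_insert, hR₁, Finset.mem_filter, mem_Ioo]
  rcases this.1.eq_or_lt with h | h
  · exact Or.inl h.symm
  rcases this.2.eq_or_lt with h' | h'
  · exact Or.inr (Or.inl h')
  · exact Or.inr (Or.inr ⟨hr, h, h'⟩)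

end Chain

/-! ### Weak limits of plans with fixed marginals -/

section Limits

variable {ι : Type*} {F : Filter ι}

/-- The bound involves the plan only through its marginals. Replacing measurable functions by
continuous ones is therefore uniform over all plans with the same marginals. -/
theorem abs_integral_sub_le_of_marginals {σ : Measure (ℝ × ℝ)} [IsProbabilityMeasure σ]
    {f h : ℝ → ℝ} (hf : Measurable f) (hh : Measurable h) (hf1 : ∀ x, |f x| ≤ 1)
    (hh1 : ∀ x, |h x| ≤ 1) (f' h' : BoundedContinuousFunction ℝ ℝ) :
    |∫ p, f p.1 * h p.2 ∂σ - ∫ p, f' p.1 * h' p.2 ∂σ| ≤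
      ∫ y, |h y - h' y| ∂σ.snd + ‖h'‖ * ∫ x, |f x - f' x| ∂σ.fst := by
  have bdd : ∀ {g : ℝ × ℝ → ℝ} (C : ℝ), Measurable g → (∀ p, |g p| ≤ C) → Integrable g σ :=
    fun {g} C hg hC => Integrable.of_bound hg.aestronglyMeasurable C
      (Eventually.of_forall fun p => by rw [Real.norm_eq_abs]; exact hC p)
  have hf'm : Measurable f' := f'.continuous.measurable
  have hh'm : Measurable h' := h'.continuous.measurable
  have hf'b : ∀ x, |f' x| ≤ ‖f'‖ := fun x => f'.norm_coe_le_norm x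
  have hh'b : ∀ x, |h' x| ≤ ‖h'‖ := fun x => h'.norm_coe_le_norm x
  have i1 : Integrable (fun p : ℝ × ℝ => f p.1 * h p.2) σ :=
    bdd 1 (by fun_prop) fun p => by
      rw [abs_mul]; exact mul_le_one₀ (hf1 _) (abs_nonneg _) (hh1 _)
  have i2 : Integrable (fun p : ℝ × ℝ => f' p.1 * h' p.2) σ :=
    bdd (‖f'‖ * ‖h'‖) (by fun_prop) fun p => by
      rw [abs_mul]; exact mul_le_mul (hf'b _) (hh'b _) (abs_nonneg _) (norm_nonneg _)
  have i3 : Integrable (fun p : ℝ × ℝ => |h p.2 - h' p.2|) σ :=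
    bdd (1 + ‖h'‖) (by fun_prop) fun p => by
      rw [abs_abs]; exact (abs_sub _ _).trans (add_le_add (hh1 _) (hh'b _))
  have i4 : Integrable (fun p : ℝ × ℝ => |f p.1 - f' p.1|) σ :=
    bdd (1 + ‖f'‖) (by fun_prop) fun p => by
      rw [abs_abs]; exact (abs_sub _ _).trans (add_le_add (hf1 _) (hf'b _))
  have e1 : ∫ y, |h y - h' y| ∂σ.snd = ∫ p, |h p.2 - h' p.2| ∂σ :=
    integral_map (φ := Prod.snd) measurable_snd.aemeasurable (f := fun y => |h y - h' y|)
      (by fun_prop)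
  have e2 : ∫ x, |f x - f' x| ∂σ.fst = ∫ p, |f p.1 - f' p.1| ∂σ :=
    integral_map (φ := Prod.fst) measurable_fst.aemeasurable (f := fun x => |f x - f' x|)
      (by fun_prop)
  rw [e1, e2, ← integral_sub i1 i2, ← integral_const_mul, ← integral_add i3 (i4.const_mul _)]
  refine abs_integral_le_integral_abs.trans
    (integral_mono (i1.sub i2).abs (i3.add (i4.const_mul _)) fun p => ?_)
  have : f p.1 * h p.2 - f' p.1 * h' p.2
      = f p.1 * (h p.2 - h' p.2) + h' p.2 * (f p.1 - f' p.1) := by ring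
  simp only
  rw [this]
  refine (abs_add_le _ _).trans ?_
  rw [abs_mul, abs_mul]
  refine add_le_add ?_ ?_
  · exact mul_le_of_le_one_left (abs_nonneg _) (hf1 _)
  · exact mul_le_mul_of_nonneg_right (hh'b _) (abs_nonneg _)

/-- Weak convergence of plans with fixed marginals can be tested on products of bounded measurable
functions. -/
theorem tendsto_integral_mul {π : ι → ProbabilityMeasure (ℝ × ℝ)} {ρ : ProbabilityMeasure (ℝ × ℝ)}
    (hlim : Tendsto π F (𝓝 ρ)) {ν ν' : Measure ℝ} [IsProbabilityMeasure ν]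
    [IsProbabilityMeasure ν']
    (hfst : ∀ i, (π i : Measure (ℝ × ℝ)).fst = ν) (hsnd : ∀ i, (π i : Measure (ℝ × ℝ)).snd = ν')
    (hfst' : (ρ : Measure (ℝ × ℝ)).fst = ν) (hsnd' : (ρ : Measure (ℝ × ℝ)).snd = ν')
    {f h : ℝ → ℝ} (hf : Measurable f) (hh : Measurable h) (hf1 : ∀ x, |f x| ≤ 1)
    (hh1 : ∀ x, |h x| ≤ 1) :
    Tendsto (fun i => ∫ p, f p.1 * h p.2 ∂(π i : Measure (ℝ × ℝ))) F
      (𝓝 (∫ p, f p.1 * h p.2 ∂(ρ : Measure (ℝ × ℝ)))) := by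
  rw [Metric.tendsto_nhds]
  intro ε hε
  have hfi : Integrable f ν := Integrable.of_bound hf.aestronglyMeasurable 1
    (Eventually.of_forall hf1)
  have hhi : Integrable h ν' := Integrable.of_bound hh.aestronglyMeasurable 1
    (Eventually.of_forall hh1)
  -- `h'` is chosen first because the tolerance for `f'` depends on its norm; the added `1` keeps
  -- the denominator positive.
  obtain ⟨h', hh', -⟩ := hhi.exists_boundedContinuous_integral_sub_le (ε := ε / 8) (by positivity)
  obtain ⟨f', hf', -⟩ := hfi.exists_boundedContinuous_integral_sub_le
    (ε := ε / 8 / (‖h'‖ + 1)) (by positivity)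
  have hbound : ∀ σ : ProbabilityMeasure (ℝ × ℝ), (σ : Measure (ℝ × ℝ)).fst = ν →
      (σ : Measure (ℝ × ℝ)).snd = ν' →
      |∫ p, f p.1 * h p.2 ∂(σ : Measure (ℝ × ℝ)) - ∫ p, f' p.1 * h' p.2 ∂(σ : Measure (ℝ × ℝ))|
        ≤ ε / 4 := by
    intro σ h1 h2
    refine (abs_integral_sub_le_of_marginals hf hh hf1 hh1 f' h').trans ?_
    rw [h1, h2]
    have h3 : ‖h'‖ * ∫ x, |f x - f' x| ∂ν ≤ ε / 8 := by
      calc _ ≤ (‖h'‖ + 1) * (ε / 8 / (‖h'‖ + 1)) := by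
            refine mul_le_mul (by linarith) hf' (integral_nonneg fun x => abs_nonneg _)
              (by positivity)
        _ = ε / 8 := by field_simp
    have h4 : ∫ y, |h y - h' y| ∂ν' ≤ ε / 8 := hh'
    linarith
  let g : BoundedContinuousFunction (ℝ × ℝ) ℝ :=
    f'.compContinuous ⟨Prod.fst, continuous_fst⟩ * h'.compContinuous ⟨Prod.snd, continuous_snd⟩
  have hg := (ProbabilityMeasure.tendsto_iff_forall_integral_tendsto.1 hlim) g
  have hg' := (Metric.tendsto_nhds.1 hg) (ε / 4) (by positivity)
  filter_upwards [hg'] with i hi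
  have e : ∀ σ : ProbabilityMeasure (ℝ × ℝ), ∫ p, g p ∂(σ : Measure (ℝ × ℝ))
      = ∫ p, f' p.1 * h' p.2 ∂(σ : Measure (ℝ × ℝ)) := fun σ => rfl
  rw [e, e] at hi
  rw [Real.dist_eq] at hi ⊢
  have b1 := hbound _ (hfst i) (hsnd i)
  have b2 := hbound _ hfst' hsnd'
  rw [abs_le] at b1 b2
  rw [abs_lt] at hi ⊢
  constructor <;> linarith [b1.1, b1.2, b2.1, b2.2, hi.1, hi.2]

theorem setLIntegral_eq_ofReal_integral (σ : Measure (ℝ × ℝ)) [IsProbabilityMeasure σ]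
    {A : Set ℝ} (hA : MeasurableSet A) {g : ℝ → ℝ≥0∞} (hg : Measurable g) (hg1 : ∀ x, g x ≤ 1) :
    ∫⁻ p in A ×ˢ univ, g p.2 ∂σ =
      ENNReal.ofReal (∫ p, A.indicator 1 p.1 * (g p.2).toReal ∂σ) := by
  have hmA : Measurable (A.indicator (1 : ℝ → ℝ)) := measurable_one.indicator hA
  have hnn : ∀ p : ℝ × ℝ, 0 ≤ A.indicator (1 : ℝ → ℝ) p.1 * (g p.2).toReal := fun p =>
    mul_nonneg (indicator_nonneg (fun _ _ => zero_le_one) _) ENNReal.toReal_nonneg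
  have hle : ∀ x, (g x).toReal ≤ 1 := fun x => by
    simpa using ENNReal.toReal_mono ENNReal.one_ne_top (hg1 x)
  have hA1 : ∀ x, A.indicator (1 : ℝ → ℝ) x ≤ 1 := fun x =>
    indicator_le_self' (fun _ _ => zero_le_one) x
  rw [ofReal_integral_eq_lintegral_ofReal _ (Eventually.of_forall hnn),
    ← lintegral_indicator (hA.prod MeasurableSet.univ)]
  · refine lintegral_congr fun p => ?_
    by_cases hp : p.1 ∈ A
    · rw [indicator_of_mem (by simp [hp]), indicator_of_mem hp, Pi.one_apply, one_mul,
        ENNReal.ofReal_toReal ((hg1 _).trans_lt ENNReal.one_lt_top).ne]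
    · rw [indicator_of_notMem (by simp [hp]), indicator_of_notMem hp, zero_mul, ENNReal.ofReal_zero]
  · refine Integrable.of_bound (by fun_prop) 1 (Eventually.of_forall fun p => ?_)
    rw [Real.norm_eq_abs, abs_of_nonneg (hnn p)]
    exact mul_le_one₀ (hA1 _) ENNReal.toReal_nonneg (hle _)

theorem tendsto_setLIntegral_snd {π : ι → ProbabilityMeasure (ℝ × ℝ)}
    {ρ : ProbabilityMeasure (ℝ × ℝ)}
    (hlim : Tendsto π F (𝓝 ρ)) {ν ν' : Measure ℝ} [IsProbabilityMeasure ν]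
    [IsProbabilityMeasure ν']
    (hfst : ∀ i, (π i : Measure (ℝ × ℝ)).fst = ν) (hsnd : ∀ i, (π i : Measure (ℝ × ℝ)).snd = ν')
    (hfst' : (ρ : Measure (ℝ × ℝ)).fst = ν) (hsnd' : (ρ : Measure (ℝ × ℝ)).snd = ν')
    {A : Set ℝ} (hA : MeasurableSet A) {g : ℝ → ℝ≥0∞} (hg : Measurable g) (hg1 : ∀ x, g x ≤ 1) :
    Tendsto (fun i => ∫⁻ p in A ×ˢ univ, g p.2 ∂(π i : Measure (ℝ × ℝ))) F
      (𝓝 (∫⁻ p in A ×ˢ univ, g p.2 ∂(ρ : Measure (ℝ × ℝ)))) := by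
  simp_rw [setLIntegral_eq_ofReal_integral _ hA hg hg1]
  refine (ENNReal.continuous_ofReal.tendsto _).comp ?_
  refine tendsto_integral_mul hlim hfst hsnd hfst' hsnd' (measurable_one.indicator hA)
    hg.ennreal_toReal (fun x => ?_) (fun x => ?_)
  · by_cases hx : x ∈ A <;> simp [hx]
  · rw [abs_of_nonneg ENNReal.toReal_nonneg]
    simpa using ENNReal.toReal_mono ENNReal.one_ne_top (hg1 x)

theorem tendsto_prod {π : ι → ProbabilityMeasure (ℝ × ℝ)}
    {ρ : ProbabilityMeasure (ℝ × ℝ)}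
    (hlim : Tendsto π F (𝓝 ρ)) {ν ν' : Measure ℝ} [IsProbabilityMeasure ν]
    [IsProbabilityMeasure ν']
    (hfst : ∀ i, (π i : Measure (ℝ × ℝ)).fst = ν) (hsnd : ∀ i, (π i : Measure (ℝ × ℝ)).snd = ν')
    (hfst' : (ρ : Measure (ℝ × ℝ)).fst = ν) (hsnd' : (ρ : Measure (ℝ × ℝ)).snd = ν')
    {A B : Set ℝ} (hA : MeasurableSet A) (hB : MeasurableSet B) :
    Tendsto (fun i => (π i : Measure (ℝ × ℝ)) (A ×ˢ B)) F
      (𝓝 ((ρ : Measure (ℝ × ℝ)) (A ×ˢ B))) := by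
  have e : ∀ σ : ProbabilityMeasure (ℝ × ℝ), (σ : Measure (ℝ × ℝ)) (A ×ˢ B)
      = ∫⁻ p in A ×ˢ univ, B.indicator 1 p.2 ∂(σ : Measure (ℝ × ℝ)) := fun σ => by
    rw [setLIntegral_snd _ (measurable_one.indicator hB), lintegral_indicator_one hB,
      restrict_map_snd_apply _ hB]
  simp_rw [e]
  exact tendsto_setLIntegral_snd hlim hfst hsnd hfst' hsnd' hA (measurable_one.indicator hB)
    fun x => indicator_le_self' (fun _ _ => zero_le_one) x

/-- Increasing kernels are stable under weak limits with fixed marginals. -/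
theorem hasIncreasingKernel_of_tendsto [F.NeBot] {π : ι → ProbabilityMeasure (ℝ × ℝ)}
    {ρ : ProbabilityMeasure (ℝ × ℝ)}
    (hlim : Tendsto π F (𝓝 ρ)) {ν ν' : Measure ℝ} [IsProbabilityMeasure ν]
    [IsProbabilityMeasure ν']
    (hfst : ∀ i, (π i : Measure (ℝ × ℝ)).fst = ν) (hsnd : ∀ i, (π i : Measure (ℝ × ℝ)).snd = ν')
    (hfst' : (ρ : Measure (ℝ × ℝ)).fst = ν) (hsnd' : (ρ : Measure (ℝ × ℝ)).snd = ν')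
    (h : ∀ i, HasIncreasingKernel (π i)) : HasIncreasingKernel ρ := by
  refine SlopeCondition.hasIncreasingKernel fun a b c d z hbc => ?_
  have t : ∀ {A B : Set ℝ}, MeasurableSet A → MeasurableSet B → _ := fun {A B} hA hB =>
    tendsto_prod hlim hfst hsnd hfst' hsnd' hA hB
  refine le_of_tendsto_of_tendsto
    (ENNReal.Tendsto.mul (t measurableSet_Icc measurableSet_Iic) (Or.inr (measure_ne_top _ _))
      (t measurableSet_Icc MeasurableSet.univ) (Or.inr (measure_ne_top _ _)))
    (ENNReal.Tendsto.mul (t measurableSet_Icc measurableSet_Iic) (Or.inr (measure_ne_top _ _))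
      (t measurableSet_Icc MeasurableSet.univ) (Or.inr (measure_ne_top _ _)))
    (Eventually.of_forall fun i => (h i).slopeCondition a b c d z hbc)

theorem tendsto_transpose {π : ι → ProbabilityMeasure (ℝ × ℝ)}
    {ρ : ProbabilityMeasure (ℝ × ℝ)} (hlim : Tendsto π F (𝓝 ρ)) :
    Tendsto (fun i => transpose (π i)) F (𝓝 (transpose ρ)) :=
  ((ProbabilityMeasure.continuous_map continuous_swap).tendsto ρ).comp hlim

theorem fst_eq_of_tendsto [F.NeBot] {π : ι → ProbabilityMeasure (ℝ × ℝ)}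
    {ρ : ProbabilityMeasure (ℝ × ℝ)} (hlim : Tendsto π F (𝓝 ρ)) {ν : ProbabilityMeasure ℝ}
    (hfst : ∀ i, (π i : Measure (ℝ × ℝ)).fst = ν) : (ρ : Measure (ℝ × ℝ)).fst = ν := by
  have h1 := ((ProbabilityMeasure.continuous_map continuous_fst).tendsto ρ).comp hlim
  have h2 : ∀ i, (π i).map (f := Prod.fst) continuous_fst.measurable.aemeasurable = ν :=
    fun i => Subtype.ext (hfst i)
  have h3 := tendsto_nhds_unique (h1.congr h2) tendsto_const_nhds
  exact congrArg (fun σ : ProbabilityMeasure ℝ => (σ : Measure ℝ)) h3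

theorem snd_eq_of_tendsto [F.NeBot] {π : ι → ProbabilityMeasure (ℝ × ℝ)}
    {ρ : ProbabilityMeasure (ℝ × ℝ)} (hlim : Tendsto π F (𝓝 ρ)) {ν : ProbabilityMeasure ℝ}
    (hsnd : ∀ i, (π i : Measure (ℝ × ℝ)).snd = ν) : (ρ : Measure (ℝ × ℝ)).snd = ν := by
  rw [← transpose_fst]
  exact fst_eq_of_tendsto (tendsto_transpose hlim) fun i => by rw [transpose_fst, hsnd]

/-- Couplings of two fixed laws are uniformly tight, since a product of compact sets misses at most
the sum of the marginal defects. -/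
theorem isCompact_closure_couplings (ν ν' : ProbabilityMeasure ℝ) :
    IsCompact (closure {π : ProbabilityMeasure (ℝ × ℝ) |
      (π : Measure (ℝ × ℝ)).fst = ν ∧ (π : Measure (ℝ × ℝ)).snd = ν'}) := by
  apply isCompact_closure_of_isTightMeasureSet
  rw [isTightMeasureSet_iff_exists_isCompact_measure_compl_le]
  intro ε hε
  have hε2 : 0 < ε / 2 := ENNReal.half_pos hε.ne'
  obtain ⟨K, hK, hKν⟩ := isTightMeasureSet_iff_exists_isCompact_measure_compl_le.1
    (isTightMeasureSet_singleton (μ := (ν : Measure ℝ))) (ε / 2) hε2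
  obtain ⟨K', hK', hKν'⟩ := isTightMeasureSet_iff_exists_isCompact_measure_compl_le.1
    (isTightMeasureSet_singleton (μ := (ν' : Measure ℝ))) (ε / 2) hε2
  refine ⟨K ×ˢ K', hK.prod hK', ?_⟩
  rintro _ ⟨π, ⟨h1, h2⟩, rfl⟩
  have e : (K ×ˢ K')ᶜ ⊆ Kᶜ ×ˢ univ ∪ univ ×ˢ K'ᶜ := by
    rintro ⟨x, y⟩ hp
    by_cases hx : x ∈ K
    · exact Or.inr ⟨mem_univ _, fun hy => hp ⟨hx, hy⟩⟩
    · exact Or.inl ⟨hx, mem_univ _⟩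
  calc (π : Measure (ℝ × ℝ)) (K ×ˢ K')ᶜ
      ≤ (π : Measure (ℝ × ℝ)) (Kᶜ ×ˢ univ) + (π : Measure (ℝ × ℝ)) (univ ×ˢ K'ᶜ) :=
        (measure_mono e).trans (measure_union_le _ _)
    _ = (ν : Measure ℝ) Kᶜ + (ν' : Measure ℝ) K'ᶜ := by
        rw [← h1, ← h2, fst_eq_prod_univ _ hK.measurableSet.compl,
          snd_eq_univ_prod _ hK'.measurableSet.compl]
    _ ≤ ε / 2 + ε / 2 := add_le_add (hKν _ rfl) (hKν' _ rfl)
    _ = ε := ENNReal.add_halves ε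

end Limits

/-! ### The limit of the products of quantile couplings -/

/-- `π` is the limit of the products of quantile couplings along finite subsets of `]s,t[`, as
these become finer and finer. -/
structure IsQuantileLimit (μ : ℝ → ProbabilityMeasure ℝ) (s t : ℝ)
    (π : ProbabilityMeasure (ℝ × ℝ)) : Prop where
  fst_eq : (π : Measure (ℝ × ℝ)).fst = μ s
  snd_eq : (π : Measure (ℝ × ℝ)).snd = μ t
  orthLE : ∀ R : Finset ℝ, (R : Set ℝ) ⊆ Ioo s t → OrthLE π (quantileProduct μ s t R)
  exists_ultrafilter : ∃ U : Ultrafilter (Finset ℝ), (∀ᶠ R : Finset ℝ in U, (R : Set ℝ) ⊆ Ioo s t) ∧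
    Tendsto (quantileProduct μ s t) U (𝓝 π)

variable {μ : ℝ → ProbabilityMeasure ℝ}

@[simp] theorem quantileProduct_fst (s t : ℝ) (R : Finset ℝ) :
    (quantileProduct μ s t R : Measure (ℝ × ℝ)).fst = μ s := quantileChain_fst _ _ _ _

@[simp] theorem quantileProduct_snd (s t : ℝ) (R : Finset ℝ) :
    (quantileProduct μ s t R : Measure (ℝ × ℝ)).snd = μ t := quantileChain_snd _ _ _ _

theorem hasIncreasingKernel_quantileProduct (s t : ℝ) (R : Finset ℝ) :
    HasIncreasingKernel (quantileProduct μ s t R) := hasIncreasingKernel_quantileChain _ _ _ _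

theorem hasIncreasingKernel_transpose_quantileProduct (s t : ℝ) (R : Finset ℝ) :
    HasIncreasingKernel (transpose (quantileProduct μ s t R)) :=
  hasIncreasingKernel_transpose_quantileChain _ _ _ _

/-- An ultrafilter finer than the order filter of finite subsets provides a limit by compactness,
and each fixed `R` is eventually contained in the running set, so monotonicity bounds the limit by
the product along `R`. -/
theorem exists_isQuantileLimit (μ : ℝ → ProbabilityMeasure ℝ) (s t : ℝ) :
    ∃ π, IsQuantileLimit μ s t π := by
  classical
  let U₀ : Ultrafilter (Finset (Ioo s t)) := Ultrafilter.of atTop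
  let U : Ultrafilter (Finset ℝ) := U₀.map (Finset.map (Function.Embedding.subtype _))
  obtain ⟨π, -, hπ⟩ := (isCompact_closure_couplings (μ s) (μ t)).ultrafilter_le_nhds
    (U.map (quantileProduct μ s t)) (le_principal_iff.2 (Ultrafilter.mem_map.2
      (Eventually.of_forall fun R => subset_closure
        ⟨quantileProduct_fst s t R, quantileProduct_snd s t R⟩)))
  have hlim : Tendsto (quantileProduct μ s t) U (𝓝 π) := hπ
  have h1 := fst_eq_of_tendsto hlim fun R => quantileProduct_fst s t R
  have h2 := snd_eq_of_tendsto hlim fun R => quantileProduct_snd s t R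
  refine ⟨π, h1, h2, fun R hR x y => ?_, U, ?_, hlim⟩
  · refine le_of_tendsto (tendsto_prod hlim (quantileProduct_fst s t) (quantileProduct_snd s t)
      h1 h2 measurableSet_Iic measurableSet_Iic) ?_
    let R₀ : Finset (Ioo s t) := R.subtype (· ∈ Ioo s t)
    have hge : ∀ᶠ R' in (U₀ : Filter (Finset (Ioo s t))), R₀ ⊆ R' :=
      Ultrafilter.of_le atTop (eventually_ge_atTop R₀)
    change ∀ᶠ R' in (U₀ : Filter (Finset (Ioo s t))), _
    filter_upwards [hge] with R' hR'
    refine quantileProduct_anti μ s t (fun r hr => ?_) x y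
    rw [Finset.mem_map]
    exact ⟨⟨r, hR hr⟩, hR' (by simpa [R₀] using hr), rfl⟩
  · change ∀ᶠ R' in (U₀ : Filter (Finset (Ioo s t))), _
    refine Eventually.of_forall fun R' r hr => ?_
    simp only [Finset.coe_map, mem_image] at hr
    obtain ⟨r', -, rfl⟩ := hr
    exact r'.2

namespace IsQuantileLimit

variable {s t u : ℝ} {π ρ σ : ProbabilityMeasure (ℝ × ℝ)}

theorem orthLE_Icc (h : IsQuantileLimit μ s t π) (hst : s < t) {R : Finset ℝ}
    (hR : (R : Set ℝ) ⊆ Icc s t) : OrthLE π (quantileProduct μ s t R) := by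
  rw [← quantileProduct_filter_Ioo μ hst hR]
  exact h.orthLE _ fun r hr => (Finset.mem_filter.1 hr).2

/-- With the field `orthLE`, this makes the limit a greatest lower bound, hence independent of the
ultrafilter. -/
theorem le_of_forall (h : IsQuantileLimit μ s t π)
    (hσ : ∀ R : Finset ℝ, (R : Set ℝ) ⊆ Ioo s t → OrthLE σ (quantileProduct μ s t R)) :
    OrthLE σ π := by
  obtain ⟨U, hU, hlim⟩ := h.exists_ultrafilter
  intro x y
  refine ge_of_tendsto (tendsto_prod hlim (quantileProduct_fst s t) (quantileProduct_snd s t)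
    h.fst_eq h.snd_eq measurableSet_Iic measurableSet_Iic) ?_
  filter_upwards [hU] with R hR using hσ R hR x y

theorem hasIncreasingKernel (h : IsQuantileLimit μ s t π) : HasIncreasingKernel π := by
  obtain ⟨U, hU, hlim⟩ := h.exists_ultrafilter
  exact hasIncreasingKernel_of_tendsto hlim (quantileProduct_fst s t) (quantileProduct_snd s t)
    h.fst_eq h.snd_eq (hasIncreasingKernel_quantileProduct s t)

theorem hasIncreasingKernel_transpose (h : IsQuantileLimit μ s t π) :
    HasIncreasingKernel (transpose π) := by
  obtain ⟨U, hU, hlim⟩ := h.exists_ultrafilter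
  exact hasIncreasingKernel_of_tendsto (tendsto_transpose hlim) (ν := μ t) (ν' := μ s)
    (fun R => by simp) (fun R => by simp) (by simp [h.snd_eq]) (by simp [h.fst_eq])
    (hasIncreasingKernel_transpose_quantileProduct s t)

/-- The limit is in the closure of the products, and sequences suffice to describe closures in the
weak topology. -/
theorem exists_seq (h : IsQuantileLimit μ s t π) :
    ∃ R : ℕ → Finset ℝ, (∀ n, (R n : Set ℝ) ⊆ Icc s t) ∧
      Tendsto (fun n => quantileProduct μ s t (R n)) atTop (𝓝 π) := by
  obtain ⟨U, hU, hlim⟩ := h.exists_ultrafilter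
  have hmem : π ∈ closure (quantileProduct μ s t '' {R : Finset ℝ | (R : Set ℝ) ⊆ Ioo s t}) :=
    mem_closure_of_tendsto hlim (hU.mono fun R hR => mem_image_of_mem _ hR)
  obtain ⟨x, hx, hxl⟩ := mem_closure_iff_seq_limit.1 hmem
  choose R hR hRx using hx
  exact ⟨R, fun n => (hR n).trans Ioo_subset_Icc_self, by simpa only [hRx] using hxl⟩

/-- Chapman-Kolmogorov for the limit plans. Any finite set can be refined by `t`, at which its
product splits. Monotonicity puts the product of the limits below every split product; conversely
`σ` lies below all of them, and the limit is taken in each factor separately, since the product is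
not assumed jointly continuous. -/
theorem planMul_eq (hst : s < t) (htu : t < u) (hπ : IsQuantileLimit μ s t π)
    (hρ : IsQuantileLimit μ t u ρ) (hσ : IsQuantileLimit μ s u σ) : planMul π ρ = σ := by
  classical
  refine OrthLE.antisymm (hσ.le_of_forall fun R hR => ?_) ?_
  · set R₁ := R.filter (· < t)
    set R₂ := R.filter (t < ·)
    have hsub : R ⊆ R₁ ∪ insert t R₂ := fun r hr => by
      simp only [R₁, R₂, Finset.mem_union, Finset.mem_insert, Finset.mem_filter]
      rcases lt_trichotomy r t with h | h | h
      · exact Or.inl ⟨hr, h⟩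
      · exact Or.inr (Or.inl h)
      · exact Or.inr (Or.inr ⟨hr, h⟩)
    refine OrthLE.trans ?_ (quantileProduct_anti μ s u hsub)
    rw [quantileProduct_union_insert μ (fun r hr => (Finset.mem_filter.1 hr).2)
      (fun r hr => (Finset.mem_filter.1 hr).2)]
    have l1 : OrthLE π (quantileProduct μ s t R₁) := hπ.orthLE _ fun r hr =>
      ⟨(hR (Finset.mem_filter.1 hr).1).1, (Finset.mem_filter.1 hr).2⟩
    have l2 : OrthLE ρ (quantileProduct μ t u R₂) := hρ.orthLE _ fun r hr =>
      ⟨(Finset.mem_filter.1 hr).2, (hR (Finset.mem_filter.1 hr).1).2⟩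
    refine (planMul_mono_right (by rw [hπ.snd_eq, hρ.fst_eq]) (by simp [hπ.snd_eq])
      hπ.hasIncreasingKernel_transpose l2).trans ?_
    exact planMul_mono_left (by simp [hπ.snd_eq]) (by simp)
      (hasIncreasingKernel_quantileProduct _ _ _) l1
  · have key : ∀ R R' : Finset ℝ, (R : Set ℝ) ⊆ Ioo s t → (R' : Set ℝ) ⊆ Ioo t u →
        OrthLE σ (planMul (quantileProduct μ s t R) (quantileProduct μ t u R')) := by
      intro R R' hR hR'
      rw [← quantileProduct_union_insert μ (fun r hr => (hR hr).2) (fun r hr => (hR' hr).1)]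
      refine hσ.orthLE _ fun r hr => ?_
      rcases Finset.mem_union.1 hr with hr | hr
      · exact ⟨(hR hr).1, (hR hr).2.trans htu⟩
      rcases Finset.mem_insert.1 hr with rfl | hr
      · exact ⟨hst, htu⟩
      · exact ⟨hst.trans (hR' hr).1, (hR' hr).2⟩
    obtain ⟨U, hU, hlim⟩ := hπ.exists_ultrafilter
    obtain ⟨U', hU', hlim'⟩ := hρ.exists_ultrafilter
    have step : ∀ R' : Finset ℝ, (R' : Set ℝ) ⊆ Ioo t u →
        OrthLE σ (planMul π (quantileProduct μ t u R')) := by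
      intro R' hR' x z
      have := tendsto_setLIntegral_snd hlim (quantileProduct_fst s t) (quantileProduct_snd s t)
        hπ.fst_eq hπ.snd_eq (A := Iic x) measurableSet_Iic
        (g := fun y => (quantileProduct μ t u R' : Measure (ℝ × ℝ)).condKernel y (Iic z))
        (Kernel.measurable_coe _ measurableSet_Iic) (fun y => prob_le_one)
      rw [planMul_prod _ _ measurableSet_Iic measurableSet_Iic]
      refine ge_of_tendsto this ?_
      filter_upwards [hU] with R hR
      rw [← planMul_prod _ _ measurableSet_Iic measurableSet_Iic]
      exact key R R' hR hR' x z
    have hsnd : ∀ R', (π : Measure (ℝ × ℝ)).snd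
        = (quantileProduct μ t u R' : Measure (ℝ × ℝ)).fst := fun R' => by
      rw [hπ.snd_eq, quantileProduct_fst]
    -- After transposition the varying factor comes first, and the same limit argument applies to
    -- it.
    rw [← transpose_transpose (planMul π ρ), ← transpose_transpose σ]
    refine OrthLE.transpose fun z x => ?_
    rw [transpose_planMul (by rw [hπ.snd_eq, hρ.fst_eq])]
    have := tendsto_setLIntegral_snd (tendsto_transpose hlim') (ν := μ u) (ν' := μ t)
      (fun R => by simp) (fun R => by simp) (by simp [hρ.snd_eq]) (by simp [hρ.fst_eq])
      (A := Iic z) measurableSet_Iic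
      (g := fun y => (transpose π : Measure (ℝ × ℝ)).condKernel y (Iic x))
      (Kernel.measurable_coe _ measurableSet_Iic) (fun y => prob_le_one)
    rw [planMul_prod _ _ measurableSet_Iic measurableSet_Iic]
    refine ge_of_tendsto this ?_
    filter_upwards [hU'] with R' hR'
    rw [← planMul_prod _ _ measurableSet_Iic measurableSet_Iic, ← transpose_planMul (hsnd R')]
    exact (step R' hR').transpose z x

end IsQuantileLimit

/-! ### Kolmogorov's extension theorem -/

section Kolmogorov

variable {T : Type*}

/-- A decreasing intersection of nonempty cylinders with compact bases is nonempty. -/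
theorem nonempty_iInter_cylinder {s : ℕ → Finset T} {C : ∀ n, Set (s n → ℝ)}
    (hC : ∀ n, IsCompact (C n))
    (hne : ∀ n, (⋂ i ≤ n, cylinder (α := fun _ : T => ℝ) (s i) (C i)).Nonempty) :
    (⋂ i, cylinder (α := fun _ : T => ℝ) (s i) (C i)).Nonempty := by
  choose w hw using hne
  let U : Ultrafilter ℕ := Ultrafilter.of atTop
  have hmem : ∀ i, ∀ᶠ n in (U : Filter ℕ), (s i).restrict (w n) ∈ C i := fun i => by
    refine Ultrafilter.of_le atTop ?_
    filter_upwards [eventually_ge_atTop i] with n hn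
    have := mem_iInter₂.1 (hw n) i hn
    exact this
  have hlim : ∀ i, ∃ y ∈ C i, Tendsto (fun n => (s i).restrict (w n)) U (𝓝 y) := fun i =>
    (hC i).ultrafilter_le_nhds (U.map fun n => (s i).restrict (w n))
      (le_principal_iff.2 (hmem i))
  choose y hy hyl using hlim
  have hlim' : ∀ t : T, (∃ i, t ∈ s i) → ∃ x : ℝ, Tendsto (fun n => w n t) U (𝓝 x) := by
    rintro t ⟨i, hi⟩
    exact ⟨y i ⟨t, hi⟩, ((continuous_apply (⟨t, hi⟩ : s i)).tendsto _).comp (hyl i)⟩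
  classical
  choose x hx using hlim'
  -- Coordinatewise ultrafilter limits; a coordinate that no cylinder constrains is given the
  -- default value `0`.
  refine ⟨fun t => if h : ∃ i, t ∈ s i then x t h else 0, mem_iInter.2 fun i => ?_⟩
  refine (mem_cylinder (α := fun _ : T => ℝ) (s i) (C i) _).2 ?_
  convert hy i using 1
  ext t
  have ht : ∃ j, (t : T) ∈ s j := ⟨i, t.2⟩
  rw [Finset.restrict, dif_pos ht]
  exact tendsto_nhds_unique (hx t ht) (((continuous_apply t).tendsto _).comp (hyl i))

variable {P : ∀ J : Finset T, Measure (J → ℝ)} [∀ J, IsProbabilityMeasure (P J)]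

/-- Each base is approximated from inside by a compact set with summable errors. Compactness forces
finitely many of the compact cylinders to have empty intersection, and from then on `A n` is covered
by the error cylinders. -/
theorem projectiveFamilyContent_tendsto_zero
    (hP : IsProjectiveMeasureFamily (α := fun _ : T => ℝ) P)
    {A : ℕ → Set (T → ℝ)} (A_mem : ∀ n, A n ∈ measurableCylinders fun _ : T => ℝ)
    (A_anti : Antitone A) (A_inter : ⋂ n, A n = ∅) :
    Tendsto (fun n => projectiveFamilyContent hP (A n)) atTop (𝓝 0) := by
  have A_cyl n : ∃ s S, MeasurableSet S ∧ A n = cylinder s S :=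
    (mem_measurableCylinders _).1 (A_mem n)
  choose s S mS A_eq using A_cyl
  rw [ENNReal.tendsto_atTop_zero]
  intro ε hε
  obtain ⟨δ, hδ, hδε⟩ := ENNReal.exists_pos_sum_of_countable' hε.ne' ℕ
  have hK : ∀ n, ∃ K ⊆ S n, IsCompact K ∧ P (s n) (S n \ K) < δ n := fun n =>
    (mS n).exists_isCompact_sdiff_lt (measure_ne_top _ _) (hδ n).ne'
  choose K hKS hKc hKδ using hK
  have hempty : ∃ n, (⋂ i ≤ n, cylinder (α := fun _ : T => ℝ) (s i) (K i)) = ∅ := by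
    by_contra! hne
    obtain ⟨w, hw⟩ := nonempty_iInter_cylinder hKc fun n => hne n
    have : w ∈ ⋂ n, A n := mem_iInter.2 fun n => by
      rw [A_eq]
      exact hKS n (mem_iInter.1 hw n)
    rw [A_inter] at this
    exact this
  obtain ⟨N, hN⟩ := hempty
  refine ⟨N, fun n hn => ?_⟩
  have mD : ∀ i, MeasurableSet (S i \ K i) := fun i => (mS i).diff (hKc i).measurableSet
  have hD : ∀ i, cylinder (s i) (S i \ K i) ∈ measurableCylinders fun _ : T => ℝ := fun i =>
    cylinder_mem_measurableCylinders _ _ (mD i)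
  have hsub : A n ⊆ ⋃ i ≤ N, cylinder (α := fun _ : T => ℝ) (s i) (S i \ K i) := by
    intro w hw
    by_contra hcon
    have : w ∈ ⋂ i ≤ N, cylinder (α := fun _ : T => ℝ) (s i) (K i) := by
      refine mem_iInter₂.2 fun i hi => ?_
      by_contra hwi
      refine hcon (mem_iUnion₂.2 ⟨i, hi, ?_, hwi⟩)
      have := A_anti (hi.trans hn) hw
      rw [A_eq] at this
      exact this
    rw [hN] at this
    exact this
  have hU : (⋃ i ≤ N, cylinder (α := fun _ : T => ℝ) (s i) (S i \ K i))
      ∈ measurableCylinders fun _ : T => ℝ := by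
    have := isSetRing_measurableCylinders (α := fun _ : T => ℝ).biUnion_mem (Finset.range (N + 1))
      (s := fun i => cylinder (α := fun _ : T => ℝ) (s i) (S i \ K i)) fun i _ => hD i
    simpa [Nat.lt_succ_iff] using this
  calc projectiveFamilyContent hP (A n)
      ≤ projectiveFamilyContent hP (⋃ i ≤ N, cylinder (s i) (S i \ K i)) :=
        projectiveFamilyContent_mono hP (A_mem n) hU hsub
    _ ≤ ∑ i ∈ Finset.range (N + 1), projectiveFamilyContent hP (cylinder (s i) (S i \ K i)) :=
        projectiveFamilyContent_iUnion_le hP hD N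
    _ = ∑ i ∈ Finset.range (N + 1), P (s i) (S i \ K i) :=
        Finset.sum_congr rfl fun i _ => projectiveFamilyContent_cylinder hP (mD i)
    _ ≤ ∑ i ∈ Finset.range (N + 1), δ i := Finset.sum_le_sum fun i _ => (hKδ i).le
    _ ≤ ∑' i, δ i := ENNReal.sum_le_tsum _
    _ ≤ ε := hδε.le

/-- **Kolmogorov's extension theorem** for real-valued processes. -/
theorem exists_isProjectiveLimit
    (hP : IsProjectiveMeasureFamily (α := fun _ : T => ℝ) P) :
    ∃ Q : Measure (T → ℝ), IsProjectiveLimit Q P := by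
  have hσ : (projectiveFamilyContent hP).IsSigmaSubadditive := by
    refine isSigmaSubadditive_of_addContent_iUnion_eq_tsum isSetRing_measurableCylinders
      fun f hf hf_Union hf' => ?_
    exact addContent_iUnion_eq_sum_of_tendsto_zero isSetRing_measurableCylinders
      (projectiveFamilyContent hP) (fun _ _ => projectiveFamilyContent_ne_top hP)
      (fun s hs anti_s inter_s => projectiveFamilyContent_tendsto_zero hP hs anti_s inter_s)
      hf hf_Union hf'
  refine ⟨(projectiveFamilyContent hP).measure isSetSemiring_measurableCylinders
    generateFrom_measurableCylinders.ge hσ, fun J => ?_⟩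
  ext S hS
  rw [Measure.map_apply (by fun_prop) hS, ← cylinder,
    AddContent.measure_eq _ isSetSemiring_measurableCylinders
      generateFrom_measurableCylinders.symm hσ (cylinder_mem_measurableCylinders J S hS)]
  exact projectiveFamilyContent_cylinder hP hS

end Kolmogorov

/-! ### Markov processes and their transition kernels -/

theorem present_le (s : ℝ) : present s ≤ (MeasurableSpace.pi : MeasurableSpace (ℝ → ℝ)) :=
  (measurable_pi_apply s).comap_le

theorem past_le (s : ℝ) : past s ≤ (MeasurableSpace.pi : MeasurableSpace (ℝ → ℝ)) :=
  iSup₂_le fun u _ => present_le u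

theorem measurable_past_eval {s u : ℝ} (h : u ≤ s) :
    Measurable[past s] fun w : ℝ → ℝ => w u :=
  (comap_measurable _).mono
    (le_iSup₂_of_le (f := fun u (_ : u ∈ Iic s) => present u) u h le_rfl) le_rfl

theorem coe_coupling (P : ProbabilityMeasure (ℝ → ℝ)) (s t : ℝ) :
    (coupling P s t : Measure (ℝ × ℝ))
      = (P : Measure (ℝ → ℝ)).map fun w : ℝ → ℝ => (w s, w t) := rfl

theorem coe_marginal (P : ProbabilityMeasure (ℝ → ℝ)) (t : ℝ) :
    (marginal P t : Measure ℝ) = (P : Measure (ℝ → ℝ)).map fun w : ℝ → ℝ => w t := rfl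

theorem coupling_prod (P : ProbabilityMeasure (ℝ → ℝ)) (s t : ℝ) {A B : Set ℝ}
    (hA : MeasurableSet A) (hB : MeasurableSet B) :
    (coupling P s t : Measure (ℝ × ℝ)) (A ×ˢ B)
      = (P : Measure (ℝ → ℝ)) {w | w s ∈ A ∧ w t ∈ B} := by
  rw [coe_coupling, Measure.map_apply
    ((measurable_pi_apply s).prodMk (measurable_pi_apply t)) (hA.prod hB)]
  rfl

@[simp] theorem coupling_fst (P : ProbabilityMeasure (ℝ → ℝ)) (s t : ℝ) :
    (coupling P s t : Measure (ℝ × ℝ)).fst = marginal P s :=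
  Measure.fst_map_prodMk (measurable_pi_apply t)

@[simp] theorem coupling_snd (P : ProbabilityMeasure (ℝ → ℝ)) (s t : ℝ) :
    (coupling P s t : Measure (ℝ × ℝ)).snd = marginal P t :=
  Measure.snd_map_prodMk (measurable_pi_apply s)

/-- `P` has transition kernels `k`: the law of `X_t` given the past of `s` is `k s t X_s`. -/
def HasTransitions (P : ProbabilityMeasure (ℝ → ℝ)) (k : ℝ → ℝ → Kernel ℝ ℝ) : Prop :=
  ∀ s t : ℝ, s < t → ∀ A : Set (ℝ → ℝ), MeasurableSet[past s] A → ∀ B : Set ℝ, MeasurableSet B →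
    (P : Measure (ℝ → ℝ)) (A ∩ (fun w : ℝ → ℝ => w t) ⁻¹' B)
      = ∫⁻ w in A, k s t (w s) B ∂(P : Measure (ℝ → ℝ))

/-- The transition kernels given by the two-time marginals. -/
noncomputable def couplingKernel (P : ProbabilityMeasure (ℝ → ℝ)) (s t : ℝ) : Kernel ℝ ℝ :=
  (coupling P s t : Measure (ℝ × ℝ)).condKernel

instance (P : ProbabilityMeasure (ℝ → ℝ)) (s t : ℝ) : IsMarkovKernel (couplingKernel P s t) := by
  unfold couplingKernel; infer_instance

theorem condExp_present (P : ProbabilityMeasure (ℝ → ℝ)) (s t : ℝ) {B : Set ℝ}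
    (hB : MeasurableSet B) :
    (fun w : ℝ → ℝ => (couplingKernel P s t (w s)).real B) =ᵐ[(P : Measure (ℝ → ℝ))]
      (P : Measure (ℝ → ℝ))⟦(fun w : ℝ → ℝ => w t) ⁻¹' B | present s⟧ := by
  have := condDistrib_ae_eq_condExp (μ := (P : Measure (ℝ → ℝ))) (measurable_pi_apply s)
    (measurable_pi_apply t) hB
  rw [condDistrib] at this
  exact this

theorem measurable_couplingKernel_real (P : ProbabilityMeasure (ℝ → ℝ)) (s t : ℝ) {B : Set ℝ}
    (hB : MeasurableSet B) :
    Measurable[past s] fun w : ℝ → ℝ => (couplingKernel P s t (w s)).real B :=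
  (Kernel.measurable_coe (couplingKernel P s t) hB).ennreal_toReal.comp (measurable_past_eval le_rfl)

/-- The kernel evaluated at `X_s` is a version of the conditional probability given the present. It
is measurable for the past, so being also a version given the past is a matter of integrals over
past events. -/
theorem isMarkov_iff_hasTransitions (P : ProbabilityMeasure (ℝ → ℝ)) :
    IsMarkov P ↔ HasTransitions P (couplingKernel P) := by
  have hint : ∀ (s t : ℝ) (B : Set ℝ), MeasurableSet B →
      Integrable (fun w : ℝ → ℝ => (couplingKernel P s t (w s)).real B)
        (P : Measure (ℝ → ℝ)) := fun s t B hB =>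
    Integrable.of_bound
      ((measurable_couplingKernel_real P s t hB).mono (past_le s) le_rfl).aestronglyMeasurable 1
      (Eventually.of_forall fun w => by
        rw [Real.norm_eq_abs, abs_of_nonneg measureReal_nonneg]; exact measureReal_le_one)
  have hind : ∀ (t : ℝ) (B : Set ℝ), MeasurableSet B →
      Integrable (((fun w : ℝ → ℝ => w t) ⁻¹' B).indicator fun _ => (1 : ℝ))
        (P : Measure (ℝ → ℝ)) := fun t B hB =>
    (integrable_const 1).indicator (measurable_pi_apply t hB)
  have e1 : ∀ (t : ℝ) (B : Set ℝ), MeasurableSet B → ∀ A : Set (ℝ → ℝ), MeasurableSet A →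
      ∫ w in A, ((fun w : ℝ → ℝ => w t) ⁻¹' B).indicator (fun _ => (1 : ℝ)) w
        ∂(P : Measure (ℝ → ℝ)) =
      ((P : Measure (ℝ → ℝ)) (A ∩ (fun w : ℝ → ℝ => w t) ⁻¹' B)).toReal := by
    intro t B hB A hA
    rw [integral_indicator (measurable_pi_apply t hB), setIntegral_const, smul_eq_mul, mul_one,
      measureReal_restrict_apply (measurable_pi_apply t hB), inter_comm]
    rfl
  have e2 : ∀ (s t : ℝ) (B : Set ℝ), MeasurableSet B → ∀ A : Set (ℝ → ℝ),
      ∫ w in A, (couplingKernel P s t (w s)).real B ∂(P : Measure (ℝ → ℝ)) =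
      (∫⁻ w in A, couplingKernel P s t (w s) B ∂(P : Measure (ℝ → ℝ))).toReal := by
    intro s t B hB A
    refine integral_toReal ?_ (Eventually.of_forall fun w => measure_lt_top _ _)
    exact ((Kernel.measurable_coe _ hB).comp (measurable_pi_apply s)).aemeasurable
  have hfin : ∀ (s t : ℝ) (B : Set ℝ) (A : Set (ℝ → ℝ)),
      ∫⁻ w in A, couplingKernel P s t (w s) B ∂(P : Measure (ℝ → ℝ)) ≠ ∞ := by
    intro s t B A
    refine ((lintegral_mono fun w => prob_le_one).trans_lt (b := ∫⁻ w in A, 1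
      ∂(P : Measure (ℝ → ℝ))) ?_).ne
    simp
  constructor
  · intro h s t hst A hA B hB
    have hA' := past_le s A hA
    rw [← ENNReal.toReal_eq_toReal_iff' (measure_ne_top _ _) (hfin s t B A), ← e1 t B hB A hA',
      ← e2 s t B hB A, ← setIntegral_condExp (past_le s) (hind t B hB) hA]
    refine setIntegral_congr_ae hA' ?_
    filter_upwards [h s t hst B hB, condExp_present P s t hB] with w h1 h2 _
    rw [h1, h2]
  · intro h s t hst B hB
    refine EventuallyEq.trans (EventuallyEq.symm ?_) (condExp_present P s t hB)
    refine ae_eq_condExp_of_forall_setIntegral_eq (past_le s) (hind t B hB)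
      (fun A _ _ => (hint s t B hB).integrableOn) (fun A hA _ => ?_)
      (measurable_couplingKernel_real P s t hB).stronglyMeasurable.aestronglyMeasurable
    rw [e1 t B hB A (past_le s A hA), e2 s t B hB A, h s t hst A hA B hB]

theorem HasTransitions.coupling_eq_planMul {P : ProbabilityMeasure (ℝ → ℝ)}
    (h : HasTransitions P (couplingKernel P)) {s t u : ℝ} (hst : s ≤ t) (htu : t < u) :
    coupling P s u = planMul (coupling P s t) (coupling P t u) := by
  refine plan_ext fun x z => ?_
  have hA : MeasurableSet[past t] ((fun w : ℝ → ℝ => w s) ⁻¹' Iic x) :=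
    measurable_past_eval hst measurableSet_Iic
  rw [planMul_prod _ _ measurableSet_Iic measurableSet_Iic,
    coupling_prod _ _ _ measurableSet_Iic measurableSet_Iic]
  have := h t u htu _ hA (Iic z) measurableSet_Iic
  refine this.trans ?_
  rw [coe_coupling P s t, setLIntegral_map (measurableSet_Iic.prod MeasurableSet.univ)
    (f := fun p : ℝ × ℝ => (coupling P t u : Measure (ℝ × ℝ)).condKernel p.2 (Iic z))
    ((Kernel.measurable_coe _ measurableSet_Iic).comp measurable_snd)
    ((measurable_pi_apply s).prodMk (measurable_pi_apply t))]
  congr 2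
  ext w
  simp

theorem measurableSet_past_rectangle {s : ℝ} {J : Finset ℝ} (hJ : ∀ u ∈ J, u ≤ s) {B : ℝ → Set ℝ}
    (hB : ∀ u, MeasurableSet (B u)) : MeasurableSet[past s] {w : ℝ → ℝ | ∀ u ∈ J, w u ∈ B u} := by
  have e : {w : ℝ → ℝ | ∀ u ∈ J, w u ∈ B u} = ⋂ u ∈ J, (fun w : ℝ → ℝ => w u) ⁻¹' B u := by
    ext w; simp
  rw [e]
  exact @Finset.measurableSet_biInter _ _ (past s) _ J fun u hu =>
    measurable_past_eval (hJ u hu) (hB u)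

/-- Two measures on a finite product of lines agree if they agree on rectangles. -/
theorem measure_ext_rectangle {J : Finset ℝ} {m m' : Measure (J → ℝ)} [IsProbabilityMeasure m]
    [IsProbabilityMeasure m']
    (h : ∀ B : ℝ → Set ℝ, (∀ u, MeasurableSet (B u)) →
      m (univ.pi fun u : J => B u) = m' (univ.pi fun u : J => B u)) : m = m' := by
  classical
  refine ext_of_generate_finite _ generateFrom_pi.symm isPiSystem_pi ?_ (by simp)
  rintro _ ⟨B, hB, rfl⟩
  have := h (fun u => if hu : u ∈ J then B ⟨u, hu⟩ else univ) fun u => by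
    split_ifs with hu
    · exact hB ⟨u, hu⟩ (mem_univ _)
    · exact MeasurableSet.univ
  simpa using this

theorem restrict_preimage_pi (J : Finset ℝ) (B : ℝ → Set ℝ) :
    (J.restrict : (ℝ → ℝ) → J → ℝ) ⁻¹' (univ.pi fun u : J => B u)
      = {w : ℝ → ℝ | ∀ u ∈ J, w u ∈ B u} := by
  ext w; simp [Finset.restrict]

theorem measurableSet_pi_restrict (J : Finset ℝ) {B : ℝ → Set ℝ}
    (hB : ∀ u, MeasurableSet (B u)) : MeasurableSet (univ.pi fun u : J => B u) :=
  MeasurableSet.pi countable_univ fun u _ => hB u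

theorem map_restrict_pi (P : Measure (ℝ → ℝ)) (J : Finset ℝ) {B : ℝ → Set ℝ}
    (hB : ∀ u, MeasurableSet (B u)) :
    (P.map J.restrict) (univ.pi fun u : J => B u) = P {w : ℝ → ℝ | ∀ u ∈ J, w u ∈ B u} := by
  rw [Measure.map_apply (by fun_prop) (measurableSet_pi_restrict J hB),
    restrict_preimage_pi]

/-- The transition kernels and the one-time marginals determine a Markov process. -/
theorem HasTransitions.eq_of_marginal_eq {P P' : ProbabilityMeasure (ℝ → ℝ)}
    {k : ℝ → ℝ → Kernel ℝ ℝ} (h : HasTransitions P k) (h' : HasTransitions P' k)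
    (hm : ∀ t, marginal P t = marginal P' t) : P = P' := by
  classical
  have key : ∀ J : Finset ℝ, (P : Measure (ℝ → ℝ)).map J.restrict
      = (P' : Measure (ℝ → ℝ)).map J.restrict := by
    intro J
    have hp : ∀ (P : ProbabilityMeasure (ℝ → ℝ)) (J : Finset ℝ), IsProbabilityMeasure
        ((P : Measure (ℝ → ℝ)).map (J.restrict : (ℝ → ℝ) → J → ℝ)) := fun P J =>
      Measure.isProbabilityMeasure_map (Finset.measurable_restrict J).aemeasurable
    -- The added time is later than all of `J`, so the transition from the maximum of `J` computes
    -- the new law from the old one.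
    induction J using Finset.induction_on_max with
    | empty =>
      refine measure_ext_rectangle fun B hB => ?_
      rw [map_restrict_pi _ _ hB, map_restrict_pi _ _ hB]
      simp
    | insert t J hJ ih =>
      refine measure_ext_rectangle fun B hB => ?_
      rw [map_restrict_pi _ _ hB, map_restrict_pi _ _ hB]
      have e : {w : ℝ → ℝ | ∀ u ∈ insert t J, w u ∈ B u}
          = {w : ℝ → ℝ | ∀ u ∈ J, w u ∈ B u} ∩ (fun w : ℝ → ℝ => w t) ⁻¹' B t := by
        ext w; simp [and_comm]
      rw [e]
      rcases J.eq_empty_or_nonempty with rfl | hne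
      · have e3 : ∀ P : ProbabilityMeasure (ℝ → ℝ), (P : Measure (ℝ → ℝ))
            ((fun w : ℝ → ℝ => w t) ⁻¹' B t) = (marginal P t : Measure ℝ) (B t) := fun P => by
          rw [coe_marginal, Measure.map_apply (measurable_pi_apply t) (hB t)]
        simp [e3, hm t]
      · set s := J.max' hne with hs
        have hsJ : s ∈ J := J.max'_mem hne
        have hst : s < t := hJ s hsJ
        have hA := measurableSet_past_rectangle (s := s) (J := J)
          (fun u hu => J.le_max' u hu) hB
        rw [h s t hst _ hA _ (hB t), h' s t hst _ hA _ (hB t), ← restrict_preimage_pi]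
        have hg : Measurable fun y : J → ℝ => k s t (y ⟨s, hsJ⟩) (B t) :=
          (Kernel.measurable_coe _ (hB t)).comp (measurable_pi_apply _)
        have e4 : ∀ P : ProbabilityMeasure (ℝ → ℝ),
            ∫⁻ w in (J.restrict : (ℝ → ℝ) → J → ℝ) ⁻¹' (univ.pi fun u : J => B u),
              k s t (w s) (B t) ∂(P : Measure (ℝ → ℝ))
            = ∫⁻ y in univ.pi fun u : J => B u, k s t (y ⟨s, hsJ⟩) (B t)
              ∂((P : Measure (ℝ → ℝ)).map J.restrict) := fun P => by
          rw [setLIntegral_map (measurableSet_pi_restrict J hB) hg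
            (Finset.measurable_restrict J)]
          rfl
        rw [e4, e4, ih]
  have hlim : IsProjectiveLimit (P : Measure (ℝ → ℝ))
      fun J => (P' : Measure (ℝ → ℝ)).map J.restrict := key
  have hlim' : IsProjectiveLimit (P' : Measure (ℝ → ℝ))
      fun J => (P' : Measure (ℝ → ℝ)).map J.restrict := fun J => rfl
  have : ∀ J : Finset ℝ, IsFiniteMeasure
      ((P' : Measure (ℝ → ℝ)).map (J.restrict : (ℝ → ℝ) → J → ℝ)) := fun J =>
    Measure.isFiniteMeasure_map _ _
  exact Subtype.ext (hlim.unique hlim')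

theorem IsMarkov.eq_of_coupling_eq {P P' : ProbabilityMeasure (ℝ → ℝ)} (h : IsMarkov P)
    (h' : IsMarkov P') (hc : ∀ s t, s < t → coupling P s t = coupling P' s t) : P = P' := by
  rw [isMarkov_iff_hasTransitions] at h h'
  have h'' : HasTransitions P' (couplingKernel P) := by
    intro s t hst A hA B hB
    have e : couplingKernel P s t = couplingKernel P' s t := by
      simp only [couplingKernel, hc s t hst]
    rw [h' s t hst A hA B hB, e]
  refine h.eq_of_marginal_eq h'' fun t => Subtype.ext ?_
  have h1 := coupling_fst P t (t + 1)
  rw [hc t (t + 1) (by linarith), coupling_fst] at h1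
  exact h1.symm

/-! ### Existence of Markov processes with given transition kernels -/

section Existence

variable (k : ℝ → ℝ → Kernel ℝ ℝ) (ν : ℝ → Measure ℝ)

/-- The law of a Markov chain along a list of times, started at time `s`, as a kernel with values
in the path space. -/
noncomputable def pathKernel : ℝ → List ℝ → Kernel ℝ (ℝ → ℝ)
  -- The chain starts from a constant path, so times outside the list carry an irrelevant default
  -- value, and `update` then installs the earlier values.
  | _, [] => Kernel.deterministic (fun x _ => x) (measurable_pi_lambda _ fun _ => measurable_id)
  | s, r :: l => (Kernel.id ×ₖ (pathKernel r l ∘ₖ k s r)).map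
      fun p : ℝ × (ℝ → ℝ) => Function.update p.2 s p.1

/-- The law of a Markov chain along a list of times. -/
noncomputable def pathLaw : List ℝ → Measure (ℝ → ℝ)
  | [] => Measure.dirac 0
  | s :: l => (ν s).bind (pathKernel k s l)

/-- The expectation of a product of functions of the values at the times of a list of a Markov
chain started at `x` at time `s`. -/
noncomputable def chainWeight (f : ℝ → ℝ → ℝ≥0∞) : ℝ → List ℝ → ℝ → ℝ≥0∞
  | _, [], _ => 1
  | s, r :: l, x => ∫⁻ y, f r y * chainWeight f r l y ∂(k s r x)

/-- The expectation of a product of functions of the values of a Markov chain. -/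
noncomputable def totalWeight (f : ℝ → ℝ → ℝ≥0∞) : List ℝ → ℝ≥0∞
  | [] => 1
  | s :: l => ∫⁻ x, f s x * chainWeight k f s l x ∂(ν s)

theorem measurable_update_prod (s : ℝ) :
    Measurable fun p : ℝ × (ℝ → ℝ) => Function.update p.2 s p.1 := by
  refine measurable_pi_lambda _ fun u => ?_
  by_cases h : u = s
  · subst h; simpa using measurable_fst
  · simp only [Function.update_of_ne h]
    exact (measurable_pi_apply u).comp measurable_snd

variable {k ν} in
-- Integrating out the last time puts its transition into the weight at the previous time; this is
-- the Markov property for weights.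
theorem chainWeight_append {f f' : ℝ → ℝ → ℝ≥0∞} {s t : ℝ} {l : List ℝ}
    (hl : ∀ u ∈ l, f' u = f u)
    (hs : ∀ y, f' s y = f s y * ∫⁻ z, f t z ∂(k s t y)) (r x : ℝ) :
    chainWeight k f r (l ++ [s, t]) x = chainWeight k f' r (l ++ [s]) x := by
  induction l generalizing r x with
  | nil => simp [chainWeight, hs]
  | cons a l ih =>
    simp only [List.cons_append, chainWeight]
    refine lintegral_congr fun y => ?_
    rw [ih fun u hu => hl u (by simp [hu]), hl a (by simp)]

variable {k ν} in
theorem totalWeight_append {f f' : ℝ → ℝ → ℝ≥0∞} {s t : ℝ} {l : List ℝ}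
    (hl : ∀ u ∈ l, f' u = f u)
    (hs : ∀ y, f' s y = f s y * ∫⁻ z, f t z ∂(k s t y)) :
    totalWeight k ν f (l ++ [s, t]) = totalWeight k ν f' (l ++ [s]) := by
  cases l with
  | nil => simp [totalWeight, chainWeight, hs]
  | cons a l =>
    simp only [List.cons_append, totalWeight]
    refine lintegral_congr fun y => ?_
    rw [chainWeight_append (fun u hu => hl u (by simp [hu])) hs, hl a (by simp)]

theorem measurable_chainWeight [∀ s t, IsMarkovKernel (k s t)] {f : ℝ → ℝ → ℝ≥0∞} (hf : ∀ u, Measurable (f u)) (s : ℝ)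
    (l : List ℝ) : Measurable (chainWeight k f s l) := by
  induction l generalizing s with
  | nil => exact measurable_const
  | cons r l ih => exact ((hf r).mul (ih r)).lintegral_kernel

variable [∀ s t, IsMarkovKernel (k s t)]

instance isMarkovKernel_pathKernel (s : ℝ) (l : List ℝ) : IsMarkovKernel (pathKernel k s l) := by
  induction l generalizing s with
  | nil => unfold pathKernel; infer_instance
  | cons r l ih =>
    unfold pathKernel
    exact Kernel.IsMarkovKernel.map _ (measurable_update_prod s)

instance isProbabilityMeasure_pathLaw [∀ t, IsProbabilityMeasure (ν t)] (l : List ℝ) : IsProbabilityMeasure (pathLaw k ν l) := by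
  cases l <;> unfold pathLaw <;> infer_instance

theorem measurable_listProd {f : ℝ → ℝ → ℝ≥0∞} (hf : ∀ u, Measurable (f u)) (l : List ℝ) :
    Measurable fun w : ℝ → ℝ => (l.map fun u => f u (w u)).prod := by
  induction l with
  | nil => exact measurable_const
  | cons r l ih =>
    simp only [List.map_cons, List.prod_cons]
    exact ((hf r).comp (measurable_pi_apply r)).mul ih

theorem lintegral_pathKernel {f : ℝ → ℝ → ℝ≥0∞} (hf : ∀ u, Measurable (f u)) {s : ℝ}
    {l : List ℝ} (hl : (s :: l).Pairwise (· < ·)) (x : ℝ) :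
    ∫⁻ w, ((s :: l).map fun u => f u (w u)).prod ∂(pathKernel k s l x)
      = f s x * chainWeight k f s l x := by
  induction l generalizing s x with
  | nil =>
    rw [pathKernel, Kernel.lintegral_deterministic' (f := fun w : ℝ → ℝ =>
      ([s].map fun u => f u (w u)).prod) _ (measurable_listProd hf _)]
    simp [chainWeight]
  | cons r l ih =>
    have hm := measurable_listProd hf (r :: l)
    have hm' : Measurable fun p : ℝ × (ℝ → ℝ) =>
        ((s :: r :: l).map fun u => f u (Function.update p.2 s p.1 u)).prod :=
      (measurable_listProd hf _).comp (measurable_update_prod s)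
    rw [pathKernel, Kernel.lintegral_map _ (measurable_update_prod s) _ (measurable_listProd hf _),
      Kernel.lintegral_id_prod hm']
    have e : ∀ w : ℝ → ℝ, ((s :: r :: l).map fun u => f u (Function.update w s x u)).prod
        = f s x * ((r :: l).map fun u => f u (w u)).prod := by
      intro w
      rw [List.map_cons, List.prod_cons, Function.update_self]
      congr 2
      refine List.map_congr_left fun u hu => ?_
      rw [Function.update_of_ne ((List.pairwise_cons.1 hl).1 u hu).ne']
    simp only [e]
    rw [lintegral_const_mul _ hm, Kernel.lintegral_comp _ _ _ hm, chainWeight]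
    congr 1
    exact lintegral_congr fun y => ih (List.pairwise_cons.1 hl).2 y

theorem lintegral_pathLaw {f : ℝ → ℝ → ℝ≥0∞} (hf : ∀ u, Measurable (f u))
    {l : List ℝ} (hl : l.Pairwise (· < ·)) :
    ∫⁻ w, (l.map fun u => f u (w u)).prod ∂(pathLaw k ν l) = totalWeight k ν f l := by
  cases l with
  | nil => simp [pathLaw, totalWeight]
  | cons s l =>
    rw [pathLaw, Measure.lintegral_bind (Kernel.aemeasurable _)
      (measurable_listProd hf _).aemeasurable, totalWeight]
    exact lintegral_congr fun x => lintegral_pathKernel k hf hl x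

variable {k ν}

/-- A time of weight one can be dropped: at the end of the list because kernels have mass one,
elsewhere by merging two kernels. The Chapman-Kolmogorov equations hold only almost everywhere,
hence so does the conclusion, and `pull` carries null sets back through a kernel. -/
theorem chainWeight_sublist
    (hν : ∀ s t, s < t → (ν s).bind (k s t) = ν t)
    (hk : ∀ s t u, s < t → t < u → ∀ᵐ x ∂ν s, (k t u ∘ₖ k s t) x = k s u x)
    {f : ℝ → ℝ → ℝ≥0∞} (hf : ∀ u, Measurable (f u)) {l' l : List ℝ} (h : l'.Sublist l) {s : ℝ}
    (hl : (s :: l).Pairwise (· < ·)) (h1 : ∀ u ∈ l, u ∉ l' → ∀ y, f u y = 1) :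
    chainWeight k f s l =ᵐ[ν s] chainWeight k f s l' := by
  have pull : ∀ {s t : ℝ}, s < t → ∀ {p : ℝ → Prop}, (∀ᵐ y ∂ν t, p y) →
      ∀ᵐ x ∂ν s, ∀ᵐ y ∂k s t x, p y := fun {s t} hst {p} hp => by
    rw [← hν s t hst] at hp
    exact Measure.ae_ae_of_ae_comp hp
  induction h generalizing s with
  | slnil => exact EventuallyEq.rfl
  | @cons l' l a h ih =>
    rw [List.pairwise_cons] at hl
    have hsa : s < a := hl.1 a (by simp)
    have hal : a ∉ l := fun ha => ((List.pairwise_cons.1 hl.2).1 a ha).false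
    have hfa : ∀ y, f a y = 1 := h1 a (by simp) fun ha => hal (h.subset ha)
    have ih' := ih hl.2 fun u hu hu' => h1 u (by simp [hu]) hu'
    have e1 : chainWeight k f s (a :: l) =ᵐ[ν s]
        fun x => ∫⁻ y, chainWeight k f a l' y ∂(k s a x) := by
      filter_upwards [pull hsa ih'] with x hx
      rw [chainWeight]
      refine lintegral_congr_ae ?_
      filter_upwards [hx] with y hy
      rw [hfa, one_mul, hy]
    refine e1.trans ?_
    cases l' with
    | nil => exact Eventually.of_forall fun x => by simp [chainWeight]
    | cons b l' =>
      have hab : a < b := (List.pairwise_cons.1 hl.2).1 b (h.subset (by simp))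
      have hm : Measurable fun y => f b y * chainWeight k f b l' y :=
        (hf b).mul (measurable_chainWeight k hf b l')
      filter_upwards [hk s a b hsa hab] with x hx
      rw [chainWeight, ← hx, Kernel.lintegral_comp _ _ _ hm]
      rfl
  | @cons_cons l' l a h ih =>
    rw [List.pairwise_cons] at hl
    have hsa : s < a := hl.1 a (by simp)
    have ih' := ih hl.2 fun u hu hu' => h1 u (by simp [hu]) fun hc => by
      rcases List.mem_cons.1 hc with rfl | hc
      · exact ((List.pairwise_cons.1 hl.2).1 u hu).false
      · exact hu' hc
    filter_upwards [pull hsa ih'] with x hx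
    rw [chainWeight, chainWeight]
    refine lintegral_congr_ae ?_
    filter_upwards [hx] with y hy
    rw [hy]

theorem totalWeight_sublist [∀ t, IsProbabilityMeasure (ν t)]
    (hν : ∀ s t, s < t → (ν s).bind (k s t) = ν t)
    (hk : ∀ s t u, s < t → t < u → ∀ᵐ x ∂ν s, (k t u ∘ₖ k s t) x = k s u x)
    {f : ℝ → ℝ → ℝ≥0∞} (hf : ∀ u, Measurable (f u)) {l' l : List ℝ} (h : l'.Sublist l)
    (hl : l.Pairwise (· < ·)) (h1 : ∀ u ∈ l, u ∉ l' → ∀ y, f u y = 1) :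
    totalWeight k ν f l = totalWeight k ν f l' := by
  induction h with
  | slnil => rfl
  | @cons l' l a h ih =>
    have hal : a ∉ l := fun ha => ((List.pairwise_cons.1 hl).1 a ha).false
    have hfa : ∀ y, f a y = 1 := h1 a (by simp) fun ha => hal (h.subset ha)
    have h1' : ∀ u ∈ l, u ∉ l' → ∀ y, f u y = 1 := fun u hu hu' => h1 u (by simp [hu]) hu'
    rw [totalWeight, lintegral_congr_ae (g := chainWeight k f a l')]
    swap
    · filter_upwards [chainWeight_sublist hν hk hf h hl h1'] with x hx
      rw [hfa, one_mul, hx]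
    cases l' with
    | nil => simp [chainWeight, totalWeight]
    | cons b l' =>
      have hab : a < b := (List.pairwise_cons.1 hl).1 b (h.subset (by simp))
      have hm : Measurable fun y => f b y * chainWeight k f b l' y :=
        (hf b).mul (measurable_chainWeight k hf b l')
      -- No kernel precedes the first time, so it is dropped by transporting the initial marginal.
      rw [totalWeight, ← hν a b hab, Measure.lintegral_bind (Kernel.aemeasurable _) hm.aemeasurable]
      rfl
  | @cons_cons l' l a h ih =>
    rw [totalWeight, totalWeight]
    refine lintegral_congr_ae ?_
    filter_upwards [chainWeight_sublist hν hk hf h hl fun u hu hu' => h1 u (by simp [hu])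
      fun hc => by
        rcases List.mem_cons.1 hc with rfl | hc
        · exact ((List.pairwise_cons.1 hl).1 u hu).false
        · exact hu' hc] with x hx
    rw [hx]

theorem listProd_sort (J : Finset ℝ) (g : ℝ → ℝ≥0∞) :
    ((J.sort (· ≤ ·)).map g).prod = ∏ u ∈ J, g u := by
  rw [((Finset.sort_perm_toList J (· ≤ ·)).map g).prod_eq, Finset.prod_map_toList]

theorem prod_indicator_eq (J : Finset ℝ) (B : ℝ → Set ℝ) (w : ℝ → ℝ) :
    ∏ u ∈ J, (B u).indicator (1 : ℝ → ℝ≥0∞) (w u)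
      = {w : ℝ → ℝ | ∀ u ∈ J, w u ∈ B u}.indicator 1 w := by
  by_cases hw : ∀ u ∈ J, w u ∈ B u
  · rw [indicator_of_mem (show w ∈ {w : ℝ → ℝ | ∀ u ∈ J, w u ∈ B u} from hw), Pi.one_apply]
    exact Finset.prod_eq_one fun u hu => by rw [indicator_of_mem (hw u hu), Pi.one_apply]
  · rw [indicator_of_notMem (show w ∉ {w : ℝ → ℝ | ∀ u ∈ J, w u ∈ B u} from hw)]
    push Not at hw
    obtain ⟨u, hu, hu'⟩ := hw
    exact Finset.prod_eq_zero hu (indicator_of_notMem hu' _)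

theorem measurableSet_rectangle {J : Finset ℝ} {B : ℝ → Set ℝ}
    (hB : ∀ u, MeasurableSet (B u)) : MeasurableSet {w : ℝ → ℝ | ∀ u ∈ J, w u ∈ B u} := by
  rw [← restrict_preimage_pi]
  exact Finset.measurable_restrict J (measurableSet_pi_restrict J hB)

theorem sort_pairwise_lt (J : Finset ℝ) : (J.sort (· ≤ ·)).Pairwise (· < ·) :=
  J.sortedLT_sort.pairwise

theorem pathLaw_rectangle (J : Finset ℝ) {B : ℝ → Set ℝ} (hB : ∀ u, MeasurableSet (B u)) :
    pathLaw k ν (J.sort (· ≤ ·)) {w : ℝ → ℝ | ∀ u ∈ J, w u ∈ B u}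
      = totalWeight k ν (fun u => (B u).indicator 1) (J.sort (· ≤ ·)) := by
  rw [← lintegral_pathLaw k ν (fun u => measurable_one.indicator (hB u)) (sort_pairwise_lt J),
    ← lintegral_indicator_one (measurableSet_rectangle hB)]
  refine lintegral_congr fun w => ?_
  rw [listProd_sort J fun u => (B u).indicator (1 : ℝ → ℝ≥0∞) (w u), prod_indicator_eq]

variable [∀ t, IsProbabilityMeasure (ν t)]

theorem isProjectiveMeasureFamily_pathLaw
    (hν : ∀ s t, s < t → (ν s).bind (k s t) = ν t)
    (hk : ∀ s t u, s < t → t < u → ∀ᵐ x ∂ν s, (k t u ∘ₖ k s t) x = k s u x) :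
    IsProjectiveMeasureFamily (α := fun _ : ℝ => ℝ)
      fun J : Finset ℝ => (pathLaw k ν (J.sort (· ≤ ·))).map J.restrict := by
  classical
  intro I J hJI
  have hp : ∀ J : Finset ℝ, IsProbabilityMeasure
      ((pathLaw k ν (J.sort (· ≤ ·))).map (J.restrict : (ℝ → ℝ) → J → ℝ)) := fun J =>
    Measure.isProbabilityMeasure_map (Finset.measurable_restrict J).aemeasurable
  have hp' : IsProbabilityMeasure
      (((pathLaw k ν (I.sort (· ≤ ·))).map (I.restrict : (ℝ → ℝ) → I → ℝ)).map
        (Finset.restrict₂ (π := fun _ : ℝ => ℝ) hJI)) :=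
    Measure.isProbabilityMeasure_map (Finset.measurable_restrict₂ hJI).aemeasurable
  refine measure_ext_rectangle fun B hB => ?_
  rw [Measure.map_map (Finset.measurable_restrict₂ hJI) (Finset.measurable_restrict I),
    Finset.restrict₂_comp_restrict, map_restrict_pi _ _ hB, map_restrict_pi _ _ hB]
  set B' : ℝ → Set ℝ := fun u => if u ∈ J then B u else univ with hB'
  have hB'm : ∀ u, MeasurableSet (B' u) := fun u => by
    simp only [hB']; split_ifs; exacts [hB u, MeasurableSet.univ]
  have e1 : {w : ℝ → ℝ | ∀ u ∈ J, w u ∈ B u} = {w : ℝ → ℝ | ∀ u ∈ J, w u ∈ B' u} := by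
    ext w
    refine forall₂_congr fun u hu => ?_
    simp [hB', hu]
  have e2 : {w : ℝ → ℝ | ∀ u ∈ J, w u ∈ B' u} = {w : ℝ → ℝ | ∀ u ∈ I, w u ∈ B' u} := by
    ext w
    refine ⟨fun h u _ => ?_, fun h u hu => h u (hJI hu)⟩
    by_cases hu : u ∈ J
    · exact h u hu
    · simp [hB', hu]
  rw [e1, pathLaw_rectangle J hB'm, e2, pathLaw_rectangle I hB'm]
  refine (totalWeight_sublist hν hk (fun u => measurable_one.indicator (hB'm u)) ?_
    (sort_pairwise_lt I) fun u _ hu y => ?_).symm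
  · refine List.sublist_of_subperm_of_sortedLE ((Finset.sort_nodup J _).subperm fun x hx => ?_)
      (Finset.pairwise_sort J _).sortedLE (Finset.pairwise_sort I _).sortedLE
    rw [Finset.mem_sort] at hx ⊢
    exact hJI hx
  · rw [Finset.mem_sort] at hu
    simp [hB', hu]

/-- Existence of a Markov process with given one-time marginals and transition kernels satisfying
the Chapman-Kolmogorov equations. -/
theorem exists_hasTransitions
    (hν : ∀ s t, s < t → (ν s).bind (k s t) = ν t)
    (hk : ∀ s t u, s < t → t < u → ∀ᵐ x ∂ν s, (k t u ∘ₖ k s t) x = k s u x) :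
    ∃ P : ProbabilityMeasure (ℝ → ℝ), HasTransitions P k ∧
      ∀ t, (marginal P t : Measure ℝ) = ν t := by
  classical
  have hp : ∀ J : Finset ℝ, IsProbabilityMeasure
      ((pathLaw k ν (J.sort (· ≤ ·))).map (J.restrict : (ℝ → ℝ) → J → ℝ)) := fun J =>
    Measure.isProbabilityMeasure_map (Finset.measurable_restrict J).aemeasurable
  obtain ⟨Q, hQ⟩ := exists_isProjectiveLimit (isProjectiveMeasureFamily_pathLaw hν hk)
  have hQp : IsProbabilityMeasure Q := hQ.isProbabilityMeasure
  have key : ∀ (J : Finset ℝ) (f : ℝ → ℝ → ℝ≥0∞), (∀ u, Measurable (f u)) →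
      ∫⁻ w, ∏ u ∈ J, f u (w u) ∂Q = totalWeight k ν f (J.sort (· ≤ ·)) := by
    intro J f hf
    have hm : Measurable fun y : J → ℝ => ∏ u : J, f u (y u) :=
      Finset.measurable_prod _ fun u _ => (hf u).comp (measurable_pi_apply u)
    have e : ∀ m : Measure (ℝ → ℝ), ∫⁻ w, ∏ u ∈ J, f u (w u) ∂m
        = ∫⁻ y, ∏ u : J, f u (y u) ∂(m.map J.restrict) := fun m => by
      rw [lintegral_map hm (Finset.measurable_restrict J)]
      refine lintegral_congr fun w => ?_
      exact (Finset.prod_coe_sort J fun u => f u (w u)).symm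
    rw [e, hQ J, ← e, ← lintegral_pathLaw k ν hf (sort_pairwise_lt J)]
    exact lintegral_congr fun w => (listProd_sort J fun u => f u (w u)).symm
  refine ⟨⟨Q, hQp⟩, ?_, fun t => ?_⟩
  · intro s t hst A hA D hD
    have hgen := generateFrom_piiUnionInter_measurableSet present (Iic s)
    have hpi := isPiSystem_piiUnionInter (fun u => {A : Set (ℝ → ℝ) | MeasurableSet[present u] A})
      (fun u => @MeasurableSpace.isPiSystem_measurableSet _ (present u)) (Iic s)
    -- Requiring `s ∈ J` makes `s` the last time before `t`, so that the transition to `t` can be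
    -- absorbed in the weight at `s`.
    have rect : ∀ (J : Finset ℝ) (B : ℝ → Set ℝ), (∀ u ∈ J, u ≤ s) → (∀ u, MeasurableSet (B u)) →
        s ∈ J → Q ({w : ℝ → ℝ | ∀ u ∈ J, w u ∈ B u} ∩ (fun w : ℝ → ℝ => w t) ⁻¹' D)
          = ∫⁻ w in {w : ℝ → ℝ | ∀ u ∈ J, w u ∈ B u}, k s t (w s) D ∂Q := by
      intro J B hJ hB hsJ
      set C : ℝ → Set ℝ := Function.update B t D with hC
      have hCm : ∀ u, MeasurableSet (C u) := fun u => by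
        by_cases hu : u = t
        · subst hu; simpa [hC] using hD
        · simpa [hC, Function.update_of_ne hu] using hB u
      have hCJ : ∀ u ∈ J, C u = B u := fun u hu =>
        Function.update_of_ne ((hJ u hu).trans_lt hst).ne _ _
      set f : ℝ → ℝ → ℝ≥0∞ := fun u => (C u).indicator 1 with hf
      have hfm : ∀ u, Measurable (f u) := fun u => measurable_one.indicator (hCm u)
      set f' : ℝ → ℝ → ℝ≥0∞ :=
        Function.update f s fun y => f s y * ∫⁻ z, f t z ∂(k s t y) with hf'
      have hfm' : ∀ u, Measurable (f' u) := fun u => by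
        by_cases hu : u = s
        · subst hu
          simp only [hf', Function.update_self]
          exact (hfm u).mul (hfm t).lintegral_kernel
        · simpa [hf', Function.update_of_ne hu] using hfm u
      have s1 : J.sort (· ≤ ·) = (J.erase s).sort (· ≤ ·) ++ [s] := by
        have := sort_union_insert (R := J.erase s) (R' := ∅) (t := s)
          (fun r hr => lt_of_le_of_ne (hJ r (Finset.mem_of_mem_erase hr)) (Finset.ne_of_mem_erase hr))
          (by simp)
        rwa [Finset.union_insert, Finset.union_empty, Finset.insert_erase hsJ,
          Finset.sort_empty] at this
      have s2 : (insert t J).sort (· ≤ ·) = (J.erase s).sort (· ≤ ·) ++ [s, t] := by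
        have := sort_union_insert (R := J) (R' := ∅) (t := t)
          (fun r hr => (hJ r hr).trans_lt hst) (by simp)
        rw [Finset.union_insert, Finset.union_empty, Finset.sort_empty, s1] at this
        simpa using this
      have i1 : Q ({w : ℝ → ℝ | ∀ u ∈ J, w u ∈ B u} ∩ (fun w : ℝ → ℝ => w t) ⁻¹' D)
          = ∫⁻ w, ∏ u ∈ insert t J, f u (w u) ∂Q := by
        simp only [hf]
        simp_rw [prod_indicator_eq]
        rw [lintegral_indicator_one (measurableSet_rectangle hCm)]
        congr 1
        ext w
        simp only [mem_inter_iff, mem_ofPred_eq, mem_preimage, Finset.mem_insert, forall_eq_or_imp]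
        rw [and_comm]
        refine and_congr (by simp [hC]) (forall₂_congr fun u hu => by rw [hCJ u hu])
      have i2 : ∫⁻ w in {w : ℝ → ℝ | ∀ u ∈ J, w u ∈ B u}, k s t (w s) D ∂Q
          = ∫⁻ w, ∏ u ∈ J, f' u (w u) ∂Q := by
        rw [← lintegral_indicator (measurableSet_rectangle hB)]
        refine lintegral_congr fun w => ?_
        have h1 : ∏ u ∈ J, f' u (w u) = (∏ u ∈ J, f u (w u)) * k s t (w s) D := by
          rw [← Finset.mul_prod_erase J _ hsJ, ← Finset.mul_prod_erase J _ hsJ]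
          have h2 : ∏ u ∈ J.erase s, f' u (w u) = ∏ u ∈ J.erase s, f u (w u) :=
            Finset.prod_congr rfl fun u hu => by
              rw [hf', Function.update_of_ne (Finset.ne_of_mem_erase hu)]
          have h3 : f' s (w s) = f s (w s) * k s t (w s) D := by
            simp only [hf', Function.update_self]
            rw [show f t = D.indicator 1 by simp [hf, hC], lintegral_indicator_one hD]
          rw [h2, h3]
          ring
        have h4 : ∏ u ∈ J, f u (w u) = {w : ℝ → ℝ | ∀ u ∈ J, w u ∈ B u}.indicator 1 w := by
          rw [← prod_indicator_eq]
          exact Finset.prod_congr rfl fun u hu => by simp only [hf]; rw [hCJ u hu]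
        rw [h1, h4]
        by_cases hw : w ∈ {w : ℝ → ℝ | ∀ u ∈ J, w u ∈ B u}
        · rw [indicator_of_mem hw, indicator_of_mem hw, Pi.one_apply, one_mul]
        · rw [indicator_of_notMem hw, indicator_of_notMem hw, zero_mul]
      rw [i1, i2, key _ f hfm, key _ f' hfm', s1, s2]
      refine totalWeight_append (fun u hu => ?_) fun y => by simp [hf']
      rw [Finset.mem_sort] at hu
      rw [hf', Function.update_of_ne (Finset.ne_of_mem_erase hu)]
    set m₁ : Measure (ℝ → ℝ) := Q.restrict ((fun w : ℝ → ℝ => w t) ⁻¹' D) with hm₁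
    set m₂ : Measure (ℝ → ℝ) := Q.withDensity fun w => k s t (w s) D with hm₂
    have a1 : ∀ A : Set (ℝ → ℝ), MeasurableSet A →
        m₁ A = Q (A ∩ (fun w : ℝ → ℝ => w t) ⁻¹' D) := fun A hA => Measure.restrict_apply hA
    have a2 : ∀ A : Set (ℝ → ℝ), MeasurableSet A → m₂ A = ∫⁻ w in A, k s t (w s) D ∂Q :=
      fun A hA => withDensity_apply _ hA
    have fin : m₁ A = m₂ A := by
      refine ext_on_measurableSpace_of_generate_finite _ _ ?_ (past_le s) hgen.symm hpi ?_ hA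
      · rintro E ⟨J, hJ, g, hg, rfl⟩
        have hg' : ∀ u, ∃ B : Set ℝ, MeasurableSet B ∧
            (u ∈ J → (fun w : ℝ → ℝ => w u) ⁻¹' B = g u) := fun u => by
          by_cases hu : u ∈ J
          · obtain ⟨B, hB, hB'⟩ := hg u hu
            exact ⟨B, hB, fun _ => hB'⟩
          · exact ⟨univ, MeasurableSet.univ, fun h => absurd h hu⟩
        choose B hBm hBg using hg'
        set B' : ℝ → Set ℝ := fun u => if u ∈ J then B u else univ with hB'
        have hB'm : ∀ u, MeasurableSet (B' u) := fun u => by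
          simp only [hB']; split_ifs; exacts [hBm u, MeasurableSet.univ]
        -- The time `s` is added, with a trivial constraint if it was absent, to fall under `rect`.
        have e : ⋂ u ∈ J, g u = {w : ℝ → ℝ | ∀ u ∈ insert s J, w u ∈ B' u} := by
          ext w
          simp only [mem_iInter, mem_ofPred_eq]
          constructor
          · intro h u _
            by_cases hu : u ∈ J
            · have := h u hu
              rw [← hBg u hu] at this
              simpa [hB', hu] using this
            · simp [hB', hu]
          · intro h u hu
            have := h u (Finset.mem_insert_of_mem hu)
            rw [← hBg u hu]
            simpa [hB', hu] using this
        rw [e, a1 _ (measurableSet_rectangle hB'm), a2 _ (measurableSet_rectangle hB'm)]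
        refine rect _ _ (fun u hu => ?_) hB'm (by simp)
        rcases Finset.mem_insert.1 hu with rfl | hu
        exacts [le_rfl, hJ hu]
      · have := rect {s} (fun _ => univ) (by simp) (fun _ => MeasurableSet.univ) (by simp)
        rw [a1 _ MeasurableSet.univ, a2 _ MeasurableSet.univ]
        simpa using this
    change Q (A ∩ (fun w : ℝ → ℝ => w t) ⁻¹' D) = ∫⁻ w in A, k s t (w s) D ∂Q
    rw [← a1 A (past_le s A hA), ← a2 A (past_le s A hA), fin]
  · ext D hD
    change (Q.map fun w : ℝ → ℝ => w t) D = ν t D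
    rw [Measure.map_apply (measurable_pi_apply t) hD]
    have := key {t} (fun _ => D.indicator 1) fun _ => measurable_one.indicator hD
    simp only [Finset.prod_singleton, Finset.sort_singleton, totalWeight, chainWeight, mul_one]
      at this
    rw [lintegral_indicator_one hD] at this
    rw [← this, ← lintegral_indicator_one (measurable_pi_apply t hD)]
    rfl

end Existence

/-! ### The Markov-quantile process -/

theorem coe_marginal_of_mem {P : ProbabilityMeasure (ℝ → ℝ)} (hP : P ∈ Marg μ) (t : ℝ) :
    (marginal P t : Measure ℝ) = μ t := by rw [hP t]

/-- There is a Markov process whose two-time marginals are the limits of the products of quantile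
couplings. -/
theorem exists_isMarkov_isQuantileLimit (μ : ℝ → ProbabilityMeasure ℝ) :
    ∃ P ∈ Marg μ, IsMarkov P ∧ ∀ s t, s < t → IsQuantileLimit μ s t (coupling P s t) := by
  choose M hM using exists_isQuantileLimit μ
  obtain ⟨P, hPk, hPm⟩ := exists_hasTransitions
    (k := fun s t => (M s t : Measure (ℝ × ℝ)).condKernel) (ν := fun t => (μ t : Measure ℝ))
    (fun s t _ => by
      rw [← (hM s t).fst_eq, ← Measure.snd_compProd, Measure.disintegrate, (hM s t).snd_eq])
    (fun s t u hst htu => by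
      have := condKernel_planMul (M s t) (M t u)
      simp only [(hM s t).planMul_eq hst htu (hM t u) (hM s u), (hM s t).fst_eq] at this
      exact this)
  have hc : ∀ s t, s < t → coupling P s t = M s t := by
    intro s t hst
    refine plan_ext fun x y => ?_
    have hA : MeasurableSet[past s] ((fun w : ℝ → ℝ => w s) ⁻¹' Iic x) :=
      measurable_past_eval le_rfl measurableSet_Iic
    rw [coupling_prod _ _ _ measurableSet_Iic measurableSet_Iic,
      prod_eq_setLIntegral_condKernel _ measurableSet_Iic measurableSet_Iic, (hM s t).fst_eq,
      ← hPm s, coe_marginal, setLIntegral_map measurableSet_Iic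
        (Kernel.measurable_coe _ measurableSet_Iic) (measurable_pi_apply s)]
    exact hPk s t hst _ hA _ measurableSet_Iic
  refine ⟨P, fun t => Subtype.ext (hPm t), ?_, fun s t hst => by rw [hc s t hst]; exact hM s t⟩
  rw [isMarkov_iff_hasTransitions]
  intro s t hst A hA B hB
  rw [hPk s t hst A hA B hB]
  simp only [couplingKernel, hc s t hst]

/-- The two-time marginals of a Markov process with increasing kernels are smaller than the products
of quantile couplings. -/
theorem orthLE_quantileChain {P : ProbabilityMeasure (ℝ → ℝ)} (hP : P ∈ Marg μ)
    (hM : IsMarkov P) (hI : HasIncreasingKernels P) {t : ℝ} {l : List ℝ} {s : ℝ}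
    (hl : (s :: l).Pairwise (· < ·)) (hlt : ∀ r ∈ l, r < t) (hst : s < t) :
    OrthLE (coupling P s t) (quantileChain μ t s l) := by
  have hm := coe_marginal_of_mem hP
  induction l generalizing s with
  | nil => exact orthLE_quantileCoupling (by simp [hm]) (by simp [hm])
  | cons r l ih =>
    rw [List.pairwise_cons] at hl
    have hsr : s < r := hl.1 r (by simp)
    have hrt : r < t := hlt r (by simp)
    rw [((isMarkov_iff_hasTransitions P).1 hM).coupling_eq_planMul hsr.le hrt]
    refine (planMul_mono_left (π' := quantileCoupling (μ s) (μ r)) (by simp) (by simp [hm])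
      (hI r t hrt) (orthLE_quantileCoupling (by simp [hm]) (by simp [hm]))).trans ?_
    exact planMul_mono_right (by simp [hm]) (by simp)
      (hasIncreasingKernel_transpose_quantileCoupling _ _)
      (ih hl.2 (fun u hu => hlt u (by simp [hu])) hrt)

theorem orthLE_quantileProduct {P : ProbabilityMeasure (ℝ → ℝ)} (hP : P ∈ Marg μ)
    (hM : IsMarkov P) (hI : HasIncreasingKernels P) {s t : ℝ} (hst : s < t) {R : Finset ℝ}
    (hR : (R : Set ℝ) ⊆ Ioo s t) : OrthLE (coupling P s t) (quantileProduct μ s t R) := by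
  refine orthLE_quantileChain hP hM hI (List.pairwise_cons.2 ⟨fun r hr => ?_, sort_pairwise_lt R⟩)
    (fun r hr => ?_) hst
  · exact (hR ((Finset.mem_sort _).1 hr)).1
  · exact (hR ((Finset.mem_sort _).1 hr)).2

theorem condLaw_Iic {P : ProbabilityMeasure (ℝ → ℝ)} (hP : P ∈ Marg μ) (s t x z : ℝ) :
    condLaw P s t x (Iic z) = ((μ s : Measure ℝ) (Iic x))⁻¹ *
      (coupling P s t : Measure (ℝ × ℝ)) (Iic x ×ˢ Iic z) := by
  have hx : MeasurableSet {w : ℝ → ℝ | w s ≤ x} := measurable_pi_apply s measurableSet_Iic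
  rw [condLaw, Measure.map_apply (measurable_pi_apply t) measurableSet_Iic, cond_apply hx,
    coupling_prod _ _ _ measurableSet_Iic measurableSet_Iic, ← coe_marginal_of_mem hP s,
    coe_marginal, Measure.map_apply (measurable_pi_apply s) measurableSet_Iic]
  rfl

theorem stoLE_condLaw_iff {P Q : ProbabilityMeasure (ℝ → ℝ)} (hP : P ∈ Marg μ) (hQ : Q ∈ Marg μ)
    {s t x : ℝ} (hx : (μ s : Measure ℝ) (Iic x) ≠ 0) :
    StoLE (condLaw P s t x) (condLaw Q s t x) ↔ ∀ z,
      (coupling Q s t : Measure (ℝ × ℝ)) (Iic x ×ˢ Iic z)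
        ≤ (coupling P s t : Measure (ℝ × ℝ)) (Iic x ×ˢ Iic z) := by
  refine forall_congr' fun z => ?_
  rw [condLaw_Iic hP, condLaw_Iic hQ]
  exact ENNReal.mul_le_mul_iff_right (ENNReal.inv_ne_zero.2 (measure_ne_top _ _))
    (ENNReal.inv_ne_top.2 hx)

/-- Minimality of the couplings of a process amounts to the maximality of its two-time marginals for
the lower orthant order. -/
theorem hasMinimalCouplings_iff {P : ProbabilityMeasure (ℝ → ℝ)} (hP : P ∈ Marg μ) :
    HasMinimalCouplings μ P ↔ ∀ s t, s < t → ∀ Q ∈ Marg μ, IsMarkov Q → HasIncreasingKernels Q →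
      OrthLE (coupling Q s t) (coupling P s t) := by
  constructor
  · intro h s t hst Q hQ hQM hQI x z
    by_cases hx : (μ s : Measure ℝ) (Iic x) = 0
    -- Levels where conditioning is impossible carry no mass, so the comparison is trivial there.
    · refine le_of_eq_of_le (measure_mono_null (t := Iic x ×ˢ univ) ?_ ?_) zero_le
      · exact prod_mono subset_rfl (subset_univ _)
      · rw [← fst_eq_prod_univ _ measurableSet_Iic, coupling_fst, hQ s, hx]
    · exact (stoLE_condLaw_iff hP hQ hx).1 (h s t hst x hx Q hQ hQM hQI) z
  · intro h s t hst x hx Q hQ hQM hQI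
    exact (stoLE_condLaw_iff hP hQ hx).2 fun z => h s t hst Q hQ hQM hQI x z

/-- `P` is below all products of quantile couplings as a Markov process with increasing kernels,
hence below their greatest lower bound; `hle` is the reverse inequality. -/
theorem eq_of_isQuantileLimit {P Q : ProbabilityMeasure (ℝ → ℝ)} (hP : P ∈ Marg μ)
    (hM : IsMarkov P) (hI : HasIncreasingKernels P)
    (hQM : IsMarkov Q) (hQ : ∀ s t, s < t → IsQuantileLimit μ s t (coupling Q s t))
    (hle : ∀ s t, s < t → OrthLE (coupling Q s t) (coupling P s t)) : P = Q :=
  hM.eq_of_coupling_eq hQM fun s t hst => OrthLE.antisymm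
    ((hQ s t hst).le_of_forall fun _ hR => orthLE_quantileProduct hP hM hI hst hR) (hle s t hst)

/-- A Markov process whose two-time marginals are limits of products of quantile couplings is the
Markov-quantile process. -/
theorem eq_of_isLimitOfQuantileProducts {P Q : ProbabilityMeasure (ℝ → ℝ)} (hM : IsMarkov P)
    (hP : IsLimitOfQuantileProducts μ P)
    (hQM : IsMarkov Q) (hQ : ∀ s t, s < t → IsQuantileLimit μ s t (coupling Q s t)) : P = Q := by
  have hfst : ∀ s t, s < t → (coupling P s t : Measure (ℝ × ℝ)).fst = μ s := fun s t hst => by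
    obtain ⟨R, -, hlim⟩ := hP s t hst
    exact fst_eq_of_tendsto hlim fun n => quantileProduct_fst s t (R n)
  have hPm : P ∈ Marg μ := fun s => Subtype.ext <| by
    have := hfst s (s + 1) (by linarith)
    rwa [coupling_fst] at this
  have hm := coe_marginal_of_mem hPm
  refine eq_of_isQuantileLimit hPm hM (fun s t hst => ?_) hQM hQ fun s t hst x y => ?_
  · obtain ⟨R, -, hlim⟩ := hP s t hst
    exact hasIncreasingKernel_of_tendsto hlim (fun n => quantileProduct_fst s t (R n))
      (fun n => quantileProduct_snd s t (R n)) (by simp [hm]) (by simp [hm])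
      fun n => hasIncreasingKernel_quantileProduct s t (R n)
  · obtain ⟨R, hR, hlim⟩ := hP s t hst
    exact ge_of_tendsto (tendsto_prod hlim (fun n => quantileProduct_fst s t (R n))
      (fun n => quantileProduct_snd s t (R n)) (by simp [hm]) (by simp [hm])
      measurableSet_Iic measurableSet_Iic)
      (Eventually.of_forall fun n => (hQ s t hst).orthLE_Icc hst (hR n) x y)

/-! ### Increasing trajectories -/

/-- The plan `π` is concentrated on `{(x, y) | x ≤ y}`. -/
def IsUpward (π : ProbabilityMeasure (ℝ × ℝ)) : Prop :=
  ∀ q : ℝ, (π : Measure (ℝ × ℝ)) (Ioi q ×ˢ Iic q) = 0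

theorem isUpward_quantileCoupling {ν ν' : ProbabilityMeasure ℝ} (h : StoLE ν ν') :
    IsUpward (quantileCoupling ν ν') := by
  intro q
  rw [quantileCoupling_prod _ _ measurableSet_Ioi measurableSet_Iic]
  convert measure_empty (μ := (volume : Measure ℝ))
  rw [eq_empty_iff_forall_notMem]
  rintro r ⟨⟨h1, h2⟩, hr⟩
  have h3 := (quantileFun_le_iff ν' hr q).1 h2
  have h4 : cdf (ν' : Measure ℝ) q ≤ cdf (ν : Measure ℝ) q := by
    have := h q
    rw [← ofReal_cdf, ← ofReal_cdf] at this
    exact (ENNReal.ofReal_le_ofReal_iff (cdf_nonneg _ _)).1 this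
  exact absurd ((quantileFun_le_iff ν hr q).2 (h3.trans h4)) (not_le.2 h1)

/-- To go from above `q` to at most `q`, one of the two moves has to cross `q` downwards. -/
theorem IsUpward.planMul {π ρ : ProbabilityMeasure (ℝ × ℝ)}
    (h : (π : Measure (ℝ × ℝ)).snd = (ρ : Measure (ℝ × ℝ)).fst)
    (hπ : IsUpward π) (hρ : IsUpward ρ) : IsUpward (planMul π ρ) := by
  intro q
  have hm : Measurable fun y => (ρ : Measure (ℝ × ℝ)).condKernel y (Iic q) :=
    Kernel.measurable_coe _ measurableSet_Iic
  rw [planMul_prod _ _ measurableSet_Ioi measurableSet_Iic, setLIntegral_snd _ hm,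
    lintegral_eq_zero_iff hm]
  have h1 : ∀ᵐ y ∂(ρ : Measure (ℝ × ℝ)).fst,
      y ∈ Ioi q → (ρ : Measure (ℝ × ℝ)).condKernel y (Iic q) = 0 := by
    have := hρ q
    rw [prod_eq_setLIntegral_condKernel _ measurableSet_Ioi measurableSet_Iic,
      lintegral_eq_zero_iff hm] at this
    exact (ae_restrict_iff' measurableSet_Ioi).1 this
  rw [← h] at h1
  have h2 : ∀ᵐ y ∂(((π : Measure (ℝ × ℝ)).restrict (Ioi q ×ˢ univ)).map Prod.snd), y ∉ Iic q := by
    rw [← measure_eq_zero_iff_ae_notMem, restrict_map_snd_apply _ measurableSet_Iic]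
    exact hπ q
  filter_upwards [h2, (restrict_map_snd_absolutelyContinuous _ _).ae_le h1] with y hy hy'
  exact hy' (mem_Ioi.2 (not_le.1 fun h => hy (mem_Iic.2 h)))

theorem isUpward_quantileChain (h : ∀ s t : ℝ, s ≤ t → StoLE (μ s) (μ t)) {t : ℝ} {l : List ℝ}
    {s : ℝ} (hl : (s :: l).Pairwise (· < ·)) (hlt : ∀ r ∈ l, r < t) (hst : s ≤ t) :
    IsUpward (quantileChain μ t s l) := by
  induction l generalizing s with
  | nil => exact isUpward_quantileCoupling (h s t hst)
  | cons r l ih =>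
    rw [List.pairwise_cons] at hl
    exact (isUpward_quantileCoupling (h s r (hl.1 r (by simp)).le)).planMul (by simp)
      (ih hl.2 (fun u hu => hlt u (by simp [hu])) (hlt r (by simp)).le)

theorem IsQuantileLimit.isUpward (h : ∀ s t : ℝ, s ≤ t → StoLE (μ s) (μ t)) {s t : ℝ} (hst : s < t)
    {π : ProbabilityMeasure (ℝ × ℝ)} (hπ : IsQuantileLimit μ s t π) : IsUpward π := by
  obtain ⟨U, hU, hlim⟩ := hπ.exists_ultrafilter
  intro q
  refine le_antisymm (le_of_tendsto (tendsto_prod hlim (quantileProduct_fst s t)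
    (quantileProduct_snd s t) hπ.fst_eq hπ.snd_eq measurableSet_Ioi measurableSet_Iic) ?_) zero_le
  filter_upwards [hU] with R hR
  refine (isUpward_quantileChain h (List.pairwise_cons.2 ⟨fun r hr => ?_, sort_pairwise_lt R⟩)
    (fun r hr => ?_) hst.le q).le
  · exact (hR ((Finset.mem_sort _).1 hr)).1
  · exact (hR ((Finset.mem_sort _).1 hr)).2

theorem ae_le_of_isUpward {P : ProbabilityMeasure (ℝ → ℝ)} {s t : ℝ}
    (h : IsUpward (coupling P s t)) : ∀ᵐ w ∂(P : Measure (ℝ → ℝ)), w s ≤ w t := by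
  have h1 : ∀ᵐ w ∂(P : Measure (ℝ → ℝ)), ∀ q : ℚ, ¬ (w s ∈ Ioi (q : ℝ) ∧ w t ∈ Iic (q : ℝ)) := by
    rw [ae_all_iff]
    intro q
    have := h q
    rw [coupling_prod _ _ _ measurableSet_Ioi measurableSet_Iic] at this
    exact measure_eq_zero_iff_ae_notMem.1 this
  filter_upwards [h1] with w hw
  by_contra hlt
  obtain ⟨q, hq1, hq2⟩ := exists_rat_btwn (not_le.1 hlt)
  exact hw q ⟨hq2, hq1.le⟩

/-- A process on the line which is almost surely increasing between any two times has a modification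
with increasing trajectories. -/
theorem exists_monotone_modification (P : ProbabilityMeasure (ℝ → ℝ))
    (h : ∀ s t : ℝ, s ≤ t → ∀ᵐ w ∂(P : Measure (ℝ → ℝ)), w s ≤ w t) :
    ∃ X : ℝ → (ℝ → ℝ) → ℝ, (∀ t, Measurable (X t)) ∧
      (∀ t, X t =ᵐ[(P : Measure (ℝ → ℝ))] fun w => w t) ∧ ∀ w, Monotone fun t => X t w := by
  classical
  have hint : ∀ Y : (ℝ → ℝ) → ℝ, Measurable Y →
      Integrable (fun w => Real.arctan (Y w)) (P : Measure (ℝ → ℝ)) := fun Y hY =>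
    Integrable.of_bound (Real.measurable_arctan.comp hY).aestronglyMeasurable (Real.pi / 2)
      (Eventually.of_forall fun w => by
        rw [Real.norm_eq_abs, abs_le]
        exact ⟨(Real.neg_pi_div_two_lt_arctan _).le, (Real.arctan_lt_pi_div_two _).le⟩)
  -- The bounded strictly increasing function `arctan` makes expectations finite without losing
  -- information.
  set m : ℝ → ℝ := fun t => ∫ w, Real.arctan (w t) ∂(P : Measure (ℝ → ℝ)) with hm
  have hmono : Monotone m := fun s t hst =>
    integral_mono_ae (hint _ (measurable_pi_apply s)) (hint _ (measurable_pi_apply t))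
      ((h s t hst).mono fun w hw => Real.arctan_strictMono.monotone hw)
  -- A countable set of times: the rationals, for density, and the discontinuities of the monotone
  -- function `m`, where a supremum over earlier times could miss the value.
  set D : Set ℝ := range ((↑) : ℚ → ℝ) ∪ {t | ¬ ContinuousAt m t} with hD
  have hDc : D.Countable := (countable_range _).union hmono.countable_not_continuousAt
  have hDrat : ∀ q : ℚ, (q : ℝ) ∈ D := fun q => Or.inl ⟨q, rfl⟩
  set Ω : Set (ℝ → ℝ) := {w | ∀ d ∈ D, ∀ d' ∈ D, d ≤ d' → w d ≤ w d'} with hΩ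
  have hΩm : MeasurableSet Ω := by
    have : Ω = ⋂ d ∈ D, ⋂ d' ∈ D, {w : ℝ → ℝ | d ≤ d' → w d ≤ w d'} := by
      ext w; simp [hΩ]
    rw [this]
    refine MeasurableSet.biInter hDc fun d _ => MeasurableSet.biInter hDc fun d' _ => ?_
    by_cases hdd : d ≤ d'
    · simpa [hdd] using measurableSet_le (measurable_pi_apply d) (measurable_pi_apply d')
    · simp [hdd]
  have hΩae : ∀ᵐ w ∂(P : Measure (ℝ → ℝ)), w ∈ Ω := by
    simp only [hΩ, mem_ofPred_eq]
    rw [ae_ball_iff hDc]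
    intro d _
    rw [ae_ball_iff hDc]
    intro d' _
    by_cases hdd : d ≤ d'
    · exact (h d d' hdd).mono fun w hw _ => hw
    · exact Eventually.of_forall fun w hc => absurd hc hdd
  have hne : ∀ t, Nonempty ↥(D ∩ Iic t) := fun t => by
    obtain ⟨q, hq⟩ := exists_rat_lt t
    exact ⟨⟨q, hDrat q, hq.le⟩⟩
  have hcount : ∀ t, Countable ↥(D ∩ Iic t) := fun t => (hDc.mono inter_subset_left).to_subtype
  have hbdd : ∀ w ∈ Ω, ∀ t, BddAbove (range fun d : ↥(D ∩ Iic t) => w d) := by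
    intro w hw t
    obtain ⟨q, hq⟩ := exists_rat_gt t
    refine ⟨w q, ?_⟩
    rintro _ ⟨d, rfl⟩
    exact hw d d.2.1 q (hDrat q) (le_trans d.2.2 hq.le)
  -- The running supremum over `D`; on the null set of bad paths the process is set to zero, which
  -- is still monotone.
  set X : ℝ → (ℝ → ℝ) → ℝ := fun t => Ω.indicator fun w => ⨆ d : ↥(D ∩ Iic t), w d with hX
  have hXm : ∀ t, Measurable (X t) := fun t => by
    have := hcount t
    have hs : Measurable fun w : ℝ → ℝ => ⨆ d : ↥(D ∩ Iic t), w d :=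
      Measurable.iSup fun d : ↥(D ∩ Iic t) => measurable_pi_apply (d : ℝ)
    exact hs.indicator hΩm
  have hXΩ : ∀ w ∈ Ω, ∀ t, X t w = ⨆ d : ↥(D ∩ Iic t), w d := fun w hw t => indicator_of_mem hw _
  refine ⟨X, hXm, fun t => ?_, fun w s t hst => ?_⟩
  · by_cases ht : t ∈ D
    · filter_upwards [hΩae] with w hw
      rw [hXΩ w hw]
      refine le_antisymm (ciSup_le fun d => hw d d.2.1 t ht d.2.2) ?_
      exact le_ciSup (hbdd w hw t) (⟨t, ht, self_mem_Iic⟩ : ↥(D ∩ Iic t))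
    · have hcont : ContinuousAt m t := by
        by_contra hc
        exact ht (Or.inr hc)
      have hle : ∀ᵐ w ∂(P : Measure (ℝ → ℝ)), X t w ≤ w t := by
        have : ∀ᵐ w ∂(P : Measure (ℝ → ℝ)), ∀ d : ↥(D ∩ Iic t), w d ≤ w t :=
          ae_all_iff.2 fun d => h d t d.2.2
        filter_upwards [hΩae, this] with w hw hw'
        rw [hXΩ w hw]
        exact ciSup_le hw'
      -- `X t` dominates the values at rational times before `t`, whose means approach `m t` by
      -- continuity. Together with `X t ≤ w t` this forces almost sure equality.
      have hge : m t ≤ ∫ w, Real.arctan (X t w) ∂(P : Measure (ℝ → ℝ)) := by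
        by_contra hlt
        obtain ⟨l, u, htlu, hlu⟩ := mem_nhds_iff_exists_Ioo_subset.1
          (hcont.eventually (lt_mem_nhds (not_le.1 hlt)))
        obtain ⟨q, hq1, hq2⟩ := exists_rat_btwn htlu.1
        have hqm : ∫ w, Real.arctan (X t w) ∂(P : Measure (ℝ → ℝ)) < m q :=
          hlu ⟨hq1, hq2.trans htlu.2⟩
        refine absurd hqm (not_lt.2 ?_)
        refine integral_mono_ae (hint _ (measurable_pi_apply _)) (hint _ (hXm t)) ?_
        filter_upwards [hΩae] with w hw
        refine Real.arctan_strictMono.monotone ?_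
        rw [hXΩ w hw]
        exact le_ciSup (hbdd w hw t) (⟨q, hDrat q, hq2.le⟩ : ↥(D ∩ Iic t))
      have hsub : ∀ᵐ w ∂(P : Measure (ℝ → ℝ)), 0 ≤ Real.arctan (w t) - Real.arctan (X t w) :=
        hle.mono fun w hw => sub_nonneg.2 (Real.arctan_strictMono.monotone hw)
      have hzero : ∫ w, (Real.arctan (w t) - Real.arctan (X t w)) ∂(P : Measure (ℝ → ℝ)) = 0 := by
        refine le_antisymm ?_ (integral_nonneg_of_ae hsub)
        rw [integral_sub (hint _ (measurable_pi_apply t)) (hint _ (hXm t))]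
        exact sub_nonpos.2 hge
      have := (integral_eq_zero_iff_of_nonneg_ae hsub
        ((hint _ (measurable_pi_apply t)).sub (hint _ (hXm t)))).1 hzero
      filter_upwards [this] with w hw
      exact (Real.arctan_injective (sub_eq_zero.1 hw)).symm
  · by_cases hw : w ∈ Ω
    · simp only [hXΩ w hw]
      refine ciSup_le fun d => ?_
      exact le_ciSup (hbdd w hw t) (⟨d, d.2.1, le_trans d.2.2 hst⟩ : ↥(D ∩ Iic t))
    · simp [hX, hw]

end MarkovQuantile

/-! ### Existence, uniqueness and increasing trajectories -/

theorem theoremA (μ : ℝ → ProbabilityMeasure ℝ) :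
    ∃ MQ : ProbabilityMeasure (ℝ → ℝ),
      -- `MQ` has marginals `μ` and satisfies (i), (ii), (iii) and (iv)
      (MQ ∈ MarkovQuantile.Marg μ ∧ MarkovQuantile.IsMarkov MQ ∧
        MarkovQuantile.HasIncreasingKernels MQ ∧ MarkovQuantile.HasMinimalCouplings μ MQ ∧
        MarkovQuantile.IsLimitOfQuantileProducts μ MQ) ∧
      -- uniqueness under (i), (ii), (iii)
      (∀ P ∈ MarkovQuantile.Marg μ, MarkovQuantile.IsMarkov P →
        MarkovQuantile.HasIncreasingKernels P → MarkovQuantile.HasMinimalCouplings μ P →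
        P = MQ) ∧
      -- uniqueness under (i), (iv)
      (∀ P : ProbabilityMeasure (ℝ → ℝ), MarkovQuantile.IsMarkov P →
        MarkovQuantile.IsLimitOfQuantileProducts μ P → P = MQ) ∧
      -- if `μ` is increasing, `MQ` is the law of a process with increasing trajectories
      ((∀ s t : ℝ, s ≤ t → MarkovQuantile.StoLE (μ s) (μ t)) →
        ∃ (Ω : Type) (_ : MeasurableSpace Ω) (ρ : Measure Ω) (_ : IsProbabilityMeasure ρ)
          (X : ℝ → Ω → ℝ), (∀ t, Measurable (X t)) ∧
          ρ.map (fun ω t => X t ω) = (MQ : Measure (ℝ → ℝ)) ∧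
          ∀ ω, Monotone (fun t => X t ω)) := by
  obtain ⟨MQ, hmem, hM, hlim⟩ := MarkovQuantile.exists_isMarkov_isQuantileLimit μ
  have hI : MarkovQuantile.HasIncreasingKernels MQ := fun s t hst => (hlim s t hst).hasIncreasingKernel
  refine ⟨MQ, ⟨hmem, hM, hI, ?_, fun s t hst => (hlim s t hst).exists_seq⟩, ?_, ?_, ?_⟩
  · rw [MarkovQuantile.hasMinimalCouplings_iff hmem]
    intro s t hst Q hQ hQM hQI
    exact (hlim s t hst).le_of_forall fun R hR =>
      MarkovQuantile.orthLE_quantileProduct hQ hQM hQI hst hR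
  · intro P hP hPM hPI hPmin
    rw [MarkovQuantile.hasMinimalCouplings_iff hP] at hPmin
    exact MarkovQuantile.eq_of_isQuantileLimit hP hPM hPI hM hlim fun s t hst =>
      hPmin s t hst MQ hmem hM hI
  · exact fun P hPM hP => MarkovQuantile.eq_of_isLimitOfQuantileProducts hPM hP hM hlim
  · intro hμ
    obtain ⟨X, hXm, hXae, hXmono⟩ := MarkovQuantile.exists_monotone_modification MQ
      fun s t hst => by
        rcases hst.eq_or_lt with rfl | hst
        · exact Eventually.of_forall fun w => le_rfl
        · exact MarkovQuantile.ae_le_of_isUpward ((hlim s t hst).isUpward hμ hst)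
    refine ⟨ℝ → ℝ, inferInstance, MQ, inferInstance, X, hXm, ?_, hXmono⟩
    -- A modification has the same finite-dimensional laws, hence the same law on the cylindrical
    -- σ-algebra.
    have := map_eq_of_forall_ae_eq (P := (MQ : Measure (ℝ → ℝ))) (X := X) (Y := fun t w => w t)
      (measurable_pi_lambda _ hXm).aemeasurable measurable_id.aemeasurable hXae
    rw [this]
    exact Measure.map_id
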